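/- Setting. Let $\Omega\subset\mathbb{R}^n$ ($n\ge 1$) be a bounded Lipschitz domain, $V=H^1(\Omega)$ with $\|u\|_V^2=\|u\|_{L^2(\Omega)}^2+\|\nabla u\|_{L^2(\Omega)}^2$, and let $f\in L^2(\Omega)$, $\psi\in V$ and $h\in H^{1/2}(\partial\Omega)$ with $\psi\le h$ on $\partial\Omega$. Let $$K=\{u\in V : u\ge\psi \text{ in } \Omega,\ u=h \text{ on } \partial\Omega\},$$ boundary values being meant in the sense of traces. For constants $b_1,\dots,b_n,k\ge 0$ let $A\colon V\to V^*$ be $$\langle Au,v\rangle=\int_\Omega \nabla u\cdot\nabla v+\sum_{i=1}^n b_i\,\partial_{x_i}u\,v+k\,u\,v ,$$ and assume that, with constants $C_a,C_b>0$, $\|Au-Av\|_{V^*}\le C_b\|u-v\|_V$ and $\langle Au-Av,u-v\rangle\ge C_a\|u-v\|_V^2$ for all $u,v\in K$. Let $u^*\in K$ satisfy $\langle Au^*-f,u^*-v\rangle\le 0$ for all $v\in K$. Let $X,Y\subset V$ be sets with $u^*\in X\cap Y$ and $K\cap X\subset K\cap Y$ such that $K\cap Y$ is convex and closed in $V$.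 Let $\gamma>1/(2C_a)$, and let $w_{o_1},w_{b_1},w_{o_2},w_{b_2}\ge 0$ be penalty weights. An architecture $\mathcal F$ assigns to a depth $d$, a width $w$ and an activation $\sigma\colon\mathbb R\to\mathbb R$ a set $\mathcal F(d,w,\sigma)$ of functions $\mathbb R^n\to\mathbb R$ that depend on finitely many real parameters (for example feedforward or residual networks); depths and widths are positive integers. A network is regarded as an element of $V$ if its restriction to $\Omega$ belongs to $H^1(\Omega)$. Assumptions. 1. The architecture $\mathcal F^{\mathrm s}$ with activation $\sigma^{\mathrm s}$ satisfies: for every $w\in H^2(\Omega)$ and every $\epsilon>0$ there are $d,w'\in\mathbb N$ and $u\in\mathcal F^{\mathrm s}(d,w',\sigma^{\mathrm s})\cap V$ with $\|u-w\|_V\le\epsilon$. 2. The architecture $\mathcal F^{\mathrm t}$ with activation $\sigma^{\mathrm t}$ satisfies: for every $\epsilon>0$ there are $d,w'\in\mathbb N$ such that for every $k\in Y$ there is $v\in\mathcal F^{\mathrm t}(d,w',\sigma^{\mathrm t})\cap V$ with $\|v-k\|_V\le\epsilon$. 3. There is $\bar R>0$ with $\|v\|_V\le\bar R$ for all $v\in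 K\cap Y$. Let $r$ be a constant with $\|v\|_{L^2(\Omega)}\le r$ for all $v\in K\cap Y$ (for example $r=\bar R$), and let $P\ge 1+\|u^*\|_V$ and $Q\ge 1+\bar R$. For positive constants $M^{\mathrm s},B^{\mathrm s},M^{\mathrm t},B^{\mathrm t}$ put $$K_1=C_bM^{\mathrm s}+\|f\|_{V^*}+\tfrac1\gamma(M^{\mathrm s}+M^{\mathrm t}),\quad K_2=w_{o_2}(r+M^{\mathrm t}+2\|\psi\|_{L^2(\Omega)}),\quad K_3=2w_{b_2}(\|h\|_{L^2(\partial\Omega)}+B^{\mathrm t}),$$ $$K_4=C_b(M^{\mathrm s}+M^{\mathrm t})+\|Au^*-f\|_{V^*}+\tfrac1\gamma(\|u^*\|_V+M^{\mathrm t}),\quad K_5=w_{o_1}(M^{\mathrm s}+\|u^*\|_V+2\|\psi\|_{L^2(\Omega)}),\quad K_6=2w_{b_1}(\|h\|_{L^2(\partial\Omega)}+B^{\mathrm s}).$$ For sets $X^{\mathrm s},X^{\mathrm t}\subset V$ the approximation error is $$\xi_{\mathrm{app}}=\sup_{v\in K\cap Y}\ \inf_{w\in X^{\mathrm t}}\Big(K_1\|w-v\|_V+K_2\|w-v\|_{L^2(\Omega)}+K_3\|w-v\|_{L^2(\partial\Omega)}\Big)+\inf_{u\in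 X^{\mathrm s}}\Big(K_4\|u-u^*\|_V+K_5\|u-u^*\|_{L^2(\Omega)}+K_6\|u-u^*\|_{L^2(\partial\Omega)}\Big),$$ with $\inf\emptyset=+\infty$. Theorem. There is a constant $C_T>0$ with $\|u\|_{L^2(\partial\Omega)}\le C_T\|u\|_V$ for all $u\in V$, so that functions in the closed balls $B^{H^1(\Omega)}(P)$ and $B^{H^1(\Omega)}(Q)$ are bounded by $P$ and $Q$ in $V$ and by $C_TP$ and $C_TQ$ in $L^2(\partial\Omega)$. Moreover, for all positive constants $M^{\mathrm s},B^{\mathrm s},M^{\mathrm t},B^{\mathrm t}$ (in particular for those bounds, $M^{\mathrm s}=P$, $B^{\mathrm s}=C_TP$, $M^{\mathrm t}=Q$, $B^{\mathrm t}=C_TQ$) and every $\epsilon>0$ there are depths and widths $d^{\mathrm s},w^{\mathrm s},d^{\mathrm t},w^{\mathrm t}\in\mathbb N$ such that, with $$X^{\mathrm s}=\mathcal F^{\mathrm s}(d^{\mathrm s},w^{\mathrm s},\sigma^{\mathrm s})\cap B^{H^1(\Omega)}(P),\qquad X^{\mathrm t}=\mathcal F^{\mathrm t}(d^{\mathrm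 t},w^{\mathrm t},\sigma^{\mathrm t})\cap B^{H^1(\Omega)}(Q),$$ we have $\xi_{\mathrm{app}}\le\epsilon$. -/

import Mathlib

open MeasureTheory Filter Topology
open scoped ENNReal ContDiff

noncomputable section

namespace ObstacleNN

/-! ### Bounded Lipschitz domains -/

/-- The Euclidean space `ℝⁿ`. -/
abbrev E (n : ℕ) := EuclideanSpace ℝ (Fin n)

/-- `Ω ⊆ ℝⁿ` is a bounded Lipschitz domain: a bounded, nonempty, connected open set which, near each
of its boundary points, is the region above the graph of a Lipschitz function, with respect to some
orthonormal system of coordinates. Here `e` is the unit vector in the vertical direction,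
`inner ℝ x e` is the vertical coordinate of `x`, and `x - inner ℝ x e • e` is the horizontal
component of `x`, the only point at which the graph function `g` is evaluated. -/
structure IsBoundedLipschitzDomain {n : ℕ} (Ω : Set (E n)) : Prop where
  isOpen : IsOpen Ω
  isConnected : IsConnected Ω
  isBounded : Bornology.IsBounded Ω
  lipschitz_boundary : ∀ p ∈ frontier Ω, ∃ (e : E n) (g : E n → ℝ) (L : NNReal) (r : ℝ),
    ‖e‖ = 1 ∧ LipschitzWith L g ∧ 0 < r ∧
      ∀ x ∈ Metric.ball p r, x ∈ Ω ↔ g (x - inner ℝ x e • e) < inner ℝ x e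

/-- The Lebesgue measure on `Ω`. -/
abbrev vol {n : ℕ} (Ω : Set (E n)) : Measure (E n) := volume.restrict Ω

/-- The surface measure on `∂Ω`: the `(n-1)`-dimensional Hausdorff measure, with its usual
normalisation, on the boundary of `Ω`. -/
abbrev surf {n : ℕ} (Ω : Set (E n)) : Measure (E n) :=
  (Measure.euclideanHausdorffMeasure (n - 1)).restrict (frontier Ω)

/-! ### The Sobolev spaces `H¹(Ω)` and `H²(Ω)` -/

/-- `G` is the weak gradient of `u` on `Ω`. -/
def IsWeakGradient {n : ℕ} (Ω : Set (E n)) (u : E n → ℝ) (G : E n → E n) : Prop :=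
  ∀ φ : E n → ℝ, ContDiff ℝ ∞ φ → HasCompactSupport φ → tsupport φ ⊆ Ω → ∀ y : E n,
    ∫ x in Ω, u x * fderiv ℝ φ x y = - ∫ x in Ω, inner ℝ (G x) y * φ x

theorem integrable_mul_test {n : ℕ} {Ω : Set (E n)} {u v : E n → ℝ} (hu : MemLp u 2 (vol Ω))
    (hv : Continuous v) (hc : HasCompactSupport v) : Integrable (fun x => u x * v x) (vol Ω) := by
  have h2 : MemLp v 2 (vol Ω) := hv.memLp_of_hasCompactSupport hc
  exact hu.integrable_mul h2

theorem memLp_inner_const {n : ℕ} {Ω : Set (E n)} {G : E n → E n} (hG : MemLp G 2 (vol Ω))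
    (y : E n) : MemLp (fun x => inner ℝ (G x) y) 2 (vol Ω) := by
  simpa [real_inner_comm] using hG.const_inner (𝕜 := ℝ) y

theorem continuous_test_deriv {n : ℕ} {φ : E n → ℝ} (hφ : ContDiff ℝ ∞ φ) (y : E n) :
    Continuous fun x => fderiv ℝ φ x y :=
  (hφ.continuous_fderiv (by simp)).clm_apply continuous_const

theorem hasCompactSupport_test_deriv {n : ℕ} {φ : E n → ℝ} (hc : HasCompactSupport φ) (y : E n) :
    HasCompactSupport fun x => fderiv ℝ φ x y :=
  hc.fderiv_apply ℝ y

/-- The Sobolev space `V = H¹(Ω)`, realised as the space of the pairs `(u, ∇u)` with `u ∈ L²(Ω)`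
and weak gradient `∇u ∈ L²(Ω)ⁿ`. Its norm and inner product are those of `H¹(Ω)`, that is
`‖u‖² = ‖u‖²_{L²(Ω)} + ‖∇u‖²_{L²(Ω)}`. -/
def H1 {n : ℕ} (Ω : Set (E n)) : Submodule ℝ (WithLp 2 (Lp ℝ 2 (vol Ω) × Lp (E n) 2 (vol Ω))) where
  carrier := {p | IsWeakGradient Ω p.fst p.snd}
  zero_mem' := by
    intro φ _ _ _ y
    have h1 : (fun x => ((0 : Lp ℝ 2 (vol Ω)) : E n → ℝ) x * fderiv ℝ φ x y) =ᵐ[vol Ω]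
        fun _ => 0 := by
      filter_upwards [Lp.coeFn_zero ℝ 2 (vol Ω)] with x hx
      rw [hx, Pi.zero_apply, zero_mul]
    have h2 : (fun x => inner ℝ (((0 : Lp (E n) 2 (vol Ω)) : E n → E n) x) y * φ x) =ᵐ[vol Ω]
        fun _ => 0 := by
      filter_upwards [Lp.coeFn_zero (E n) 2 (vol Ω)] with x hx
      rw [hx, Pi.zero_apply, inner_zero_left, zero_mul]
    have h3 := integral_congr_ae h1
    have h4 := integral_congr_ae h2
    rw [integral_zero] at h3 h4
    change ∫ x in Ω, ((0 : Lp ℝ 2 (vol Ω)) : E n → ℝ) x * fderiv ℝ φ x y =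
      - ∫ x in Ω, inner ℝ (((0 : Lp (E n) 2 (vol Ω)) : E n → E n) x) y * φ x
    rw [h3, h4, neg_zero]
  add_mem' := by
    intro p q hp hq φ hφ hc hs y
    have h1 : (fun x => ((p.fst + q.fst : Lp ℝ 2 (vol Ω)) : E n → ℝ) x * fderiv ℝ φ x y)
        =ᵐ[vol Ω] fun x => p.fst x * fderiv ℝ φ x y + q.fst x * fderiv ℝ φ x y := by
      filter_upwards [Lp.coeFn_add p.fst q.fst] with x hx
      rw [hx, Pi.add_apply, add_mul]
    have h2 : (fun x => inner ℝ (((p.snd + q.snd : Lp (E n) 2 (vol Ω)) : E n → E n) x) y * φ x)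
        =ᵐ[vol Ω] fun x => inner ℝ (p.snd x) y * φ x + inner ℝ (q.snd x) y * φ x := by
      filter_upwards [Lp.coeFn_add p.snd q.snd] with x hx
      rw [hx, Pi.add_apply, inner_add_left, add_mul]
    have h3 := integral_congr_ae h1
    have h4 := integral_congr_ae h2
    rw [integral_add
      (integrable_mul_test (Lp.memLp p.fst) (continuous_test_deriv hφ y)
        (hasCompactSupport_test_deriv hc y))
      (integrable_mul_test (Lp.memLp q.fst) (continuous_test_deriv hφ y)
        (hasCompactSupport_test_deriv hc y)), hp φ hφ hc hs y, hq φ hφ hc hs y] at h3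
    rw [integral_add
      (integrable_mul_test (memLp_inner_const (Lp.memLp p.snd) y) hφ.continuous hc)
      (integrable_mul_test (memLp_inner_const (Lp.memLp q.snd) y) hφ.continuous hc)] at h4
    change ∫ x in Ω, ((p.fst + q.fst : Lp ℝ 2 (vol Ω)) : E n → ℝ) x * fderiv ℝ φ x y =
      - ∫ x in Ω, inner ℝ (((p.snd + q.snd : Lp (E n) 2 (vol Ω)) : E n → E n) x) y * φ x
    rw [h3, h4]
    ring
  smul_mem' := by
    intro c p hp φ hφ hc hs y
    have h1 : (fun x => ((c • p.fst : Lp ℝ 2 (vol Ω)) : E n → ℝ) x * fderiv ℝ φ x y)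
        =ᵐ[vol Ω] fun x => c * (p.fst x * fderiv ℝ φ x y) := by
      filter_upwards [Lp.coeFn_smul c p.fst] with x hx
      simp [hx, mul_assoc]
    have h2 : (fun x => inner ℝ (((c • p.snd : Lp (E n) 2 (vol Ω)) : E n → E n) x) y * φ x)
        =ᵐ[vol Ω] fun x => c * (inner ℝ (p.snd x) y * φ x) := by
      filter_upwards [Lp.coeFn_smul c p.snd] with x hx
      simp [hx, real_inner_smul_left, mul_assoc]
    have h3 := integral_congr_ae h1
    have h4 := integral_congr_ae h2
    rw [integral_const_mul, hp φ hφ hc hs y] at h3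
    rw [integral_const_mul] at h4
    change ∫ x in Ω, ((c • p.fst : Lp ℝ 2 (vol Ω)) : E n → ℝ) x * fderiv ℝ φ x y =
      - ∫ x in Ω, inner ℝ (((c • p.snd : Lp (E n) 2 (vol Ω)) : E n → E n) x) y * φ x
    rw [h3, h4]
    ring

/-- The embedding `H¹(Ω) → L²(Ω)`: the function `u` itself. -/
def val {n : ℕ} (Ω : Set (E n)) : H1 Ω →L[ℝ] Lp ℝ 2 (vol Ω) :=
  (WithLp.fstL 2 ℝ (Lp ℝ 2 (vol Ω)) (Lp (E n) 2 (vol Ω))).comp (H1 Ω).subtypeL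

/-- The weak gradient `H¹(Ω) → L²(Ω)ⁿ`. -/
def grad {n : ℕ} (Ω : Set (E n)) : H1 Ω →L[ℝ] Lp (E n) 2 (vol Ω) :=
  (WithLp.sndL 2 ℝ (Lp ℝ 2 (vol Ω)) (Lp (E n) 2 (vol Ω))).comp (H1 Ω).subtypeL

/-- The directional derivative `y · ∇u = ∑ᵢ yᵢ ∂ᵢu` in `L²(Ω)`, for a constant vector `y`. -/
def dirDeriv {n : ℕ} (Ω : Set (E n)) (y : E n) : H1 Ω →L[ℝ] Lp ℝ 2 (vol Ω) :=
  ((innerSL ℝ y).compLpL 2 (vol Ω)).comp (grad Ω)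

/-- `H²(Ω)`: the elements of `H¹(Ω)` whose first weak partial derivatives all lie in `H¹(Ω)`. -/
def H2 {n : ℕ} (Ω : Set (E n)) : Set (H1 Ω) :=
  {u | ∀ i : Fin n, ∃ w : H1 Ω, val Ω w = dirDeriv Ω (EuclideanSpace.single i 1) u}

/-! ### Boundary values -/

/-- `g ∈ L²(∂Ω)` is a trace of `u ∈ H¹(Ω)`: there are smooth functions on `ℝⁿ` that converge to `u`
in `H¹(Ω)` and whose restrictions to `∂Ω` converge to `g` in `L²(∂Ω)`. -/
def IsTrace {n : ℕ} (Ω : Set (E n)) (u : H1 Ω) (g : Lp ℝ 2 (surf Ω)) : Prop :=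
  ∃ φ : ℕ → E n → ℝ, (∀ m, ContDiff ℝ ∞ (φ m)) ∧
    Tendsto (fun m => eLpNorm (fun x => φ m x - val Ω u x) 2 (vol Ω)) atTop (𝓝 0) ∧
    Tendsto (fun m => eLpNorm (fun x => gradient (φ m) x - grad Ω u x) 2 (vol Ω)) atTop (𝓝 0) ∧
    Tendsto (fun m => eLpNorm (fun x => φ m x - g x) 2 (surf Ω)) atTop (𝓝 0)

open Classical in
/-- The trace `u|_{∂Ω} ∈ L²(∂Ω)` of `u ∈ H¹(Ω)`. (On a bounded Lipschitz domain every `u ∈ H¹(Ω)`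
has exactly one trace; on other sets the value is `0` where there is none.) -/
def trace {n : ℕ} (Ω : Set (E n)) (u : H1 Ω) : Lp ℝ 2 (surf Ω) :=
  if h : ∃ g, IsTrace Ω u g then h.choose else 0

/-- The trace space `H^{1/2}(∂Ω) ⊆ L²(∂Ω)`. -/
def Hhalf {n : ℕ} (Ω : Set (E n)) : Set (Lp ℝ 2 (surf Ω)) :=
  {h | ∃ w : H1 Ω, IsTrace Ω w h}

/-! ### The obstacle problem -/

/-- The data of the obstacle problem on `Ω`: the coefficients `b`, `k` of the differential operator
`A = -Δ + ∑ᵢ bᵢ ∂ᵢ + k`, the source `f ∈ L²(Ω)`, the obstacle `ψ ∈ H¹(Ω)` and the boundary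
values `h ∈ L²(∂Ω)`. -/
structure Data {n : ℕ} (Ω : Set (E n)) where
  b : E n
  k : ℝ
  f : Lp ℝ 2 (vol Ω)
  ψ : H1 Ω
  h : Lp ℝ 2 (surf Ω)

variable {n : ℕ} {Ω : Set (E n)}

/-- The conditions on the data: `bᵢ ≥ 0`, `k ≥ 0`, `h ∈ H^{1/2}(∂Ω)`, and `ψ ≤ h` on `∂Ω`. -/
structure Data.IsAdmissible (D : Data Ω) : Prop where
  b_nonneg : ∀ i, 0 ≤ D.b i
  k_nonneg : 0 ≤ D.k
  h_mem : D.h ∈ Hhalf Ω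
  obstacle_le : (trace Ω D.ψ : E n → ℝ) ≤ᵐ[surf Ω] D.h

/-- The feasible set `K = {u ∈ H¹(Ω) : u ≥ ψ in Ω, u = h on ∂Ω}`. -/
def Data.K (D : Data Ω) : Set (H1 Ω) :=
  {u | (val Ω D.ψ : E n → ℝ) ≤ᵐ[vol Ω] val Ω u ∧ trace Ω u = D.h}

/-- The operator `A : V → V*`, that is
`⟨A u, v⟩ = ∫_Ω ∇u · ∇v + ∑ᵢ bᵢ ∂ᵢu v + k u v`. -/
def Data.A (D : Data Ω) : H1 Ω →L[ℝ] H1 Ω →L[ℝ] ℝ :=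
  (innerSL ℝ (E := Lp (E n) 2 (vol Ω))).bilinearComp (grad Ω) (grad Ω)
    + (innerSL ℝ (E := Lp ℝ 2 (vol Ω))).bilinearComp (dirDeriv Ω D.b) (val Ω)
    + D.k • (innerSL ℝ (E := Lp ℝ 2 (vol Ω))).bilinearComp (val Ω) (val Ω)

/-- The source as an element of `V*`, that is `⟨f, v⟩ = ∫_Ω f v`. -/
def Data.F (D : Data Ω) : H1 Ω →L[ℝ] ℝ := (innerSL ℝ D.f).comp (val Ω)

/-- `u` solves the variational inequality: `u ∈ K` and `⟨A u - f, u - v⟩ ≤ 0` for all `v ∈ K`. -/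
def Data.IsSolution (D : Data Ω) (u : H1 Ω) : Prop :=
  u ∈ D.K ∧ ∀ v ∈ D.K, (D.A u - D.F) (u - v) ≤ 0

/-- `A` is Lipschitz on `K` with constant `Cb` and coercive on `K` with constant `Ca`. -/
structure Data.IsLipschitzCoercive (D : Data Ω) (Ca Cb : ℝ) : Prop where
  Ca_pos : 0 < Ca
  Cb_pos : 0 < Cb
  lipschitz : ∀ u ∈ D.K, ∀ v ∈ D.K, ‖D.A u - D.A v‖ ≤ Cb * ‖u - v‖
  coercive : ∀ u ∈ D.K, ∀ v ∈ D.K, Ca * ‖u - v‖ ^ 2 ≤ (D.A u - D.A v) (u - v)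

/-- The conditions on the sets `X` and `Y` for the solution `u`. -/
structure Data.IsAdmissiblePair (D : Data Ω) (u : H1 Ω) (X Y : Set (H1 Ω)) : Prop where
  mem : u ∈ X ∩ Y
  subset : D.K ∩ X ⊆ D.K ∩ Y
  convex : Convex ℝ (D.K ∩ Y)
  closed : IsClosed (D.K ∩ Y)

/-! ### Neural networks -/

/-- A neural network architecture with inputs in `ℝⁿ`: for each depth `d` and width `w` it has
finitely many real parameters (indexed by `Idx d w`), and each activation function `σ` and each
choice `θ` of the parameters gives a function `realize d w σ θ : ℝⁿ → ℝ`. -/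
structure Architecture (n : ℕ) where
  Idx : ℕ → ℕ → Type
  fin : ∀ d w, Finite (Idx d w)
  realize : ∀ d w, (ℝ → ℝ) → (Idx d w → ℝ) → E n → ℝ

/-- The set `𝓕(d, w, σ)` of all networks of depth `d`, width `w` and activation `σ`. -/
def Architecture.nets (F : Architecture n) (d w : ℕ) (σ : ℝ → ℝ) : Set (E n → ℝ) :=
  Set.range (F.realize d w σ)

/-- The affine map `z ↦ A z + b`. -/
def affine {m l : ℕ} (A : Fin m → Fin l → ℝ) (b : Fin m → ℝ) (z : Fin l → ℝ) : Fin m → ℝ :=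
  fun i => ∑ j, A i j * z j + b i

/-- The feedforward architecture: `T_{d+1} ∘ σ ∘ T_d ∘ ⋯ ∘ T_1 ∘ σ ∘ T_0` with affine maps
`T_0 : ℝⁿ → ℝʷ`, `T_1, …, T_d : ℝʷ → ℝʷ` and `T_{d+1} : ℝʷ → ℝ`. -/
def ffn (n : ℕ) : Architecture n where
  Idx d w := ((Fin w × Fin n) ⊕ Fin w) ⊕ (Fin d × ((Fin w × Fin w) ⊕ Fin w)) ⊕ (Fin w ⊕ Unit)
  fin _ _ := inferInstance
  realize d _ σ θ x :=
    let T₀ := affine (fun i j => θ (.inl (.inl (i, j)))) (fun i => θ (.inl (.inr i)))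
    let T (l : Fin d) := affine (fun i j => θ (.inr (.inl (l, .inl (i, j)))))
      (fun i => θ (.inr (.inl (l, .inr i))))
    let z := (List.finRange d).foldl (fun z l => σ ∘ T l z) (σ ∘ T₀ (fun j => x j))
    ∑ i, θ (.inr (.inr (.inl i))) * z i + θ (.inr (.inr (.inr ())))

/-- The deep Ritz residual architecture: `T_{d+1} ∘ B_d ∘ ⋯ ∘ B_1 ∘ T_0` with the blocks
`B_l z = σ (T_{l2} (σ (T_{l1} z))) + z` and affine maps `T_0 : ℝⁿ → ℝʷ`, `T_{lj} : ℝʷ → ℝʷ` and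
`T_{d+1} : ℝʷ → ℝ`. -/
def drr (n : ℕ) : Architecture n where
  Idx d w :=
    ((Fin w × Fin n) ⊕ Fin w) ⊕ (Fin d × Fin 2 × ((Fin w × Fin w) ⊕ Fin w)) ⊕ (Fin w ⊕ Unit)
  fin _ _ := inferInstance
  realize d _ σ θ x :=
    let T₀ := affine (fun i j => θ (.inl (.inl (i, j)))) (fun i => θ (.inl (.inr i)))
    let T (l : Fin d) (a : Fin 2) := affine (fun i j => θ (.inr (.inl (l, a, .inl (i, j)))))
      (fun i => θ (.inr (.inl (l, a, .inr i))))
    let z := (List.finRange d).foldl (fun z l => σ ∘ T l 1 (σ ∘ T l 0 z) + z) (T₀ (fun j => x j))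
    ∑ i, θ (.inr (.inr (.inl i))) * z i + θ (.inr (.inr (.inr ())))

/-- The networks in `𝓕(d, w, σ)` that belong to `H¹(Ω)`, as elements of `H¹(Ω)`. -/
def Architecture.netsH1 (Ω : Set (E n)) (F : Architecture n) (d w : ℕ) (σ : ℝ → ℝ) :
    Set (H1 Ω) :=
  {u | ∃ N ∈ F.nets d w σ, (val Ω u : E n → ℝ) =ᵐ[vol Ω] N}

/-- The set `𝓕(d, w, σ) ∩ B^{H¹(Ω)}(R)`, with the closed ball of radius `R` around `0`. -/
def Architecture.netsBall (Ω : Set (E n)) (F : Architecture n) (d w : ℕ) (σ : ℝ → ℝ) (R : ℝ) :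
    Set (H1 Ω) :=
  F.netsH1 Ω d w σ ∩ Metric.closedBall 0 R

/-- Density in `H¹(Ω)` for targets in `H²(Ω)`. -/
def IsDenseForH2 (Ω : Set (E n)) (F : Architecture n) (σ : ℝ → ℝ) : Prop :=
  ∀ w ∈ H2 Ω, ∀ ε : ℝ, 0 < ε → ∃ d wd : ℕ, 0 < d ∧ 0 < wd ∧
    ∃ u ∈ F.netsH1 Ω d wd σ, ‖u - w‖ ≤ ε

/-- Density in `H¹(Ω)` for targets in `Y`, with depth and width independent of the target. -/
def IsUniformlyDenseFor (Y : Set (H1 Ω)) (F : Architecture n) (σ : ℝ → ℝ) : Prop :=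
  ∀ ε : ℝ, 0 < ε → ∃ d wd : ℕ, 0 < d ∧ 0 < wd ∧
    ∀ k ∈ Y, ∃ v ∈ F.netsH1 Ω d wd σ, ‖v - k‖ ≤ ε

/-! ### The approximation error -/

/-- The parameter `γ` of the gap function and the penalty weights (index `1` for the solution,
`2` for the test function; `o` for the obstacle, `b` for the boundary condition). -/
structure Weights where
  γ : ℝ
  wo1 : ℝ
  wb1 : ℝ
  wo2 : ℝ
  wb2 : ℝ

/-- Bounds for the `H¹(Ω)` norm (`Ms`, `Mt`) and the `L²(∂Ω)` norm (`Bs`, `Bt`) of the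
solution (`s`) and the test (`t`) networks. -/
structure Bounds where
  Ms : ℝ
  Bs : ℝ
  Mt : ℝ
  Bt : ℝ

/-- `K₁ = C_b Mˢ + ‖f‖_{V*} + (Mˢ + Mᵗ)/γ`. -/
def K₁ (D : Data Ω) (Cb : ℝ) (W : Weights) (B : Bounds) : ℝ :=
  Cb * B.Ms + ‖D.F‖ + (1 / W.γ) * (B.Ms + B.Mt)

/-- `K₂ = w_{o2} (r + Mᵗ + 2 ‖ψ‖_{L²(Ω)})`, where `r` bounds the elements of `K ∩ Y`. -/
def K₂ (D : Data Ω) (r : ℝ) (W : Weights) (B : Bounds) : ℝ :=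
  W.wo2 * (r + B.Mt + 2 * ‖val Ω D.ψ‖)

/-- `K₃ = 2 w_{b2} (‖h‖_{L²(∂Ω)} + Bᵗ)`. -/
def K₃ (D : Data Ω) (W : Weights) (B : Bounds) : ℝ :=
  2 * W.wb2 * (‖D.h‖ + B.Bt)

/-- `K₄ = C_b (Mˢ + Mᵗ) + ‖A u* - f‖_{V*} + (‖u*‖_V + Mᵗ)/γ`. -/
def K₄ (D : Data Ω) (Cb : ℝ) (ustar : H1 Ω) (W : Weights) (B : Bounds) : ℝ :=
  Cb * (B.Ms + B.Mt) + ‖D.A ustar - D.F‖ + (1 / W.γ) * (‖ustar‖ + B.Mt)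

/-- `K₅ = w_{o1} (Mˢ + ‖u*‖_V + 2 ‖ψ‖_{L²(Ω)})`. -/
def K₅ (D : Data Ω) (ustar : H1 Ω) (W : Weights) (B : Bounds) : ℝ :=
  W.wo1 * (B.Ms + ‖ustar‖ + 2 * ‖val Ω D.ψ‖)

/-- `K₆ = 2 w_{b1} (‖h‖_{L²(∂Ω)} + Bˢ)`. -/
def K₆ (D : Data Ω) (W : Weights) (B : Bounds) : ℝ :=
  2 * W.wb1 * (‖D.h‖ + B.Bs)

/-- The weighted norm `c₁ ‖u‖_V + c₂ ‖u‖_{L²(Ω)} + c₃ ‖u‖_{L²(∂Ω)}`. -/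
def wnorm (c₁ c₂ c₃ : ℝ) (u : H1 Ω) : ℝ :=
  c₁ * ‖u‖ + c₂ * ‖val Ω u‖ + c₃ * ‖trace Ω u‖

/-- The approximation error
`ξ_app = sup_{v ∈ K ∩ Y} inf_{w ∈ Xt} (K₁ ‖w - v‖_V + K₂ ‖w - v‖_{L²(Ω)} + K₃ ‖w - v‖_{L²(∂Ω)})
  + inf_{u ∈ Xs} (K₄ ‖u - u*‖_V + K₅ ‖u - u*‖_{L²(Ω)} + K₆ ‖u - u*‖_{L²(∂Ω)})`,
as an extended nonnegative real number. In particular it is infinite if `Xs` is empty. -/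
def xiApp (D : Data Ω) (Cb r : ℝ) (ustar : H1 Ω) (W : Weights) (B : Bounds)
    (Y Xs Xt : Set (H1 Ω)) : ℝ≥0∞ :=
  (⨆ v ∈ D.K ∩ Y, ⨅ w ∈ Xt,
      ENNReal.ofReal (wnorm (K₁ D Cb W B) (K₂ D r W B) (K₃ D W B) (w - v)))
    + ⨅ u ∈ Xs,
      ENNReal.ofReal (wnorm (K₄ D Cb ustar W B) (K₅ D ustar W B) (K₆ D W B) (u - ustar))

end ObstacleNN

end

namespace ObstacleNN

open scoped Convolution
open ContinuousLinearMap (lsmul)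

variable {n : ℕ} {Ω : Set (E n)}

/-! ### The trace inequality -/

/-! If a network is `δ`-close to its target in `H¹(Ω)`, the weighted norm of the error is at most a
fixed constant times `δ`: the `L²(Ω)` norm is below the `H¹(Ω)` norm, and the boundary norm is
controlled by the trace inequality (`wnorm_le`). For the test networks one size serves all `v ∈ K ∩
Y`, so the supremum does no harm. For the solution network only `u*` has to be approximated, but
`u*` is merely in `H¹(Ω)` while the density assumption concerns `H²(Ω)`; a smooth function is
interposed. Taking `δ ≤ 1` keeps all these networks in the balls of radius `P` and `Q`.

The analysis lies in two facts about bounded Lipschitz domains.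

Trace inequality (`exists_lintegral_surf_le`): near a boundary point, vertical segments of fixed
length starting on the graph run inside `Ω`. The fundamental theorem of calculus bounds `φ²` at the
foot of a segment by the energy along it. Integrating over the hyperplane and using that a Lipschitz
graph map distorts surface measure boundedly gives a local estimate; compactness of the boundary
makes it global.

Density of smooth functions (`exists_contDiff_norm_sub_le`): extend `u` by zero and convolve with a
kernel centred off the origin, so that near the boundary it samples only points of `Ω` and the jump
of the extension is never seen. A partition of unity glues the local approximations.

Together they make the boundary values of smooth approximations a Cauchy sequence, so every `u` has
a trace, and the inequality passes to the limit. -/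

theorem eLpNorm_two_sq {α F : Type*} [MeasurableSpace α] [NormedAddCommGroup F] (μ : Measure α)
    (f : α → F) : eLpNorm f 2 μ ^ 2 = ∫⁻ x, ‖f x‖ₑ ^ 2 ∂μ := by
  have h := eLpNorm_nnreal_pow_eq_lintegral (μ := μ) (f := f) (p := 2) (by norm_num)
  norm_num at h
  exact_mod_cast h

/-- The parametrisation of the graph of `g` over the hyperplane orthogonal to `e`. -/
noncomputable def graphMap (e : E n) (g : E n → ℝ) (y : (ℝ ∙ e)ᗮ) : E n := (y : E n) + g y • e

theorem lipschitzWith_graphMap {e : E n} (he : ‖e‖ = 1) {g : E n → ℝ} {L : NNReal}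
    (hg : LipschitzWith L g) : LipschitzWith (1 + L) (graphMap e g) := by
  refine LipschitzWith.add (LipschitzWith.subtype_val _) ?_
  refine LipschitzWith.of_dist_le_mul fun x y => ?_
  rw [dist_eq_norm, ← sub_smul, norm_smul, he, mul_one, ← dist_eq_norm]
  exact hg.dist_le_mul _ _

theorem inner_add_smul_unit {e : E n} (he : ‖e‖ = 1) (y : (ℝ ∙ e)ᗮ) (t : ℝ) :
    inner ℝ ((y : E n) + t • e) e = t := by
  have h := Submodule.mem_orthogonal_singleton_iff_inner_left.1 y.2
  rw [inner_add_left, h, real_inner_smul_left, real_inner_self_eq_norm_sq, he]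
  norm_num

/-- Identifies the exponent of the surface measure with the dimension of the hyperplane, where that
Hausdorff measure is Lebesgue measure. -/
theorem finrank_orthogonal_unit {e : E n} (he : ‖e‖ = 1) :
    Module.finrank ℝ (ℝ ∙ e)ᗮ = n - 1 := by
  have h := Submodule.finrank_add_finrank_orthogonal (ℝ ∙ e)
  rw [finrank_span_singleton (by intro h0; simp [h0] at he), finrank_euclideanSpace_fin] at h
  omega

/-- The surface measure of a piece of a Lipschitz graph is controlled by the Lebesgue measure of
its projection. -/
theorem restrict_le_map_graphMap {e : E n} (he : ‖e‖ = 1) {g : E n → ℝ} {L : NNReal}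
    (hg : LipschitzWith L g) {S : Set (E n)}
    (hSg : S ⊆ Set.range (graphMap e g)) :
    (Measure.euclideanHausdorffMeasure (n - 1) : Measure (E n)).restrict S ≤
      ((1 + L : NNReal) : ℝ≥0∞) ^ (n - 1) •
        ((volume.restrict (graphMap e g ⁻¹' S)).map (graphMap e g)) := by
  have hl := lipschitzWith_graphMap he hg
  have hm : Measurable (graphMap e g) := hl.continuous.measurable
  refine Measure.le_intro fun s hs _ => ?_
  rw [Measure.restrict_apply hs, Measure.smul_apply, Measure.map_apply hm hs,
    Measure.restrict_apply (hm hs), ← Set.preimage_inter]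
  have h1 : s ∩ S = graphMap e g '' (graphMap e g ⁻¹' (s ∩ S)) := by
    rw [Set.image_preimage_eq_inter_range, Set.inter_eq_left.2 (Set.inter_subset_right.trans hSg)]
  conv_lhs => rw [h1]
  -- The same normalising factor of the Hausdorff measure appears on both sides, so only the
  -- unnormalised Lipschitz estimate remains.
  have hv := InnerProductSpace.euclideanHausdorffMeasure_eq_volume (V := (ℝ ∙ e)ᗮ)
  rw [finrank_orthogonal_unit he] at hv
  rw [← hv, Measure.euclideanHausdorffMeasure_def, Measure.euclideanHausdorffMeasure_def,
    Measure.smul_apply, Measure.smul_apply, smul_eq_mul, ENNReal.smul_def, ENNReal.smul_def,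
    smul_eq_mul, smul_eq_mul, mul_left_comm]
  gcongr
  have h2 := hl.hausdorffMeasure_image_le (d := ((n - 1 : ℕ) : ℝ)) (by positivity)
    (graphMap e g ⁻¹' (s ∩ S))
  rwa [ENNReal.rpow_natCast] at h2

/-- From `f(0)² = f(t)² - ∫₀ᵗ 2 f f'` and `2 |f f'| ≤ f² + f'²` one bounds `f(0)²` for each `t`;
integrating over `t ∈ [0, s]` gives the claim. -/
theorem sq_le_integral_of_contDiff {f : ℝ → ℝ} (hf : ContDiff ℝ 1 f) {s : ℝ} (hs : 0 < s) :
    s * f 0 ^ 2 ≤ (1 + s) * ∫ t in (0)..s, (f t ^ 2 + deriv f t ^ 2) := by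
  have hd : Continuous (deriv f) := hf.continuous_deriv le_rfl
  have hf0 : Continuous f := hf.continuous
  have hc : Continuous fun t => f t ^ 2 + deriv f t ^ 2 := by fun_prop
  set I := ∫ t in (0)..s, (f t ^ 2 + deriv f t ^ 2) with hI
  have key : ∀ t ∈ Set.Icc 0 s, f 0 ^ 2 ≤ (f t ^ 2 + deriv f t ^ 2) + I := by
    intro t ht
    have h1 : ∫ x in (0)..t, 2 * f x * deriv f x = f t ^ 2 - f 0 ^ 2 := by
      refine intervalIntegral.integral_eq_sub_of_hasDerivAt (f := fun x => f x ^ 2)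
        (fun x _ => ?_) ((by fun_prop : Continuous fun x => 2 * f x * deriv f x).intervalIntegrable
          _ _)
      simpa using ((hf.differentiable one_ne_zero x).hasDerivAt.fun_pow 2)
    have h2 : -I ≤ ∫ x in (0)..t, 2 * f x * deriv f x := by
      have h3 : ∫ x in (0)..t, -(f x ^ 2 + deriv f x ^ 2) ≤ ∫ x in (0)..t, 2 * f x * deriv f x :=
        intervalIntegral.integral_mono_on ht.1 (hc.neg.intervalIntegrable _ _)
          ((by fun_prop : Continuous fun x => 2 * f x * deriv f x).intervalIntegrable _ _)
          fun x _ => by nlinarith [sq_nonneg (f x + deriv f x)]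
      rw [intervalIntegral.integral_neg] at h3
      have h4 : ∫ x in (0)..t, (f x ^ 2 + deriv f x ^ 2) ≤ I :=
        intervalIntegral.integral_mono_interval le_rfl ht.1 ht.2
          (Eventually.of_forall fun x => by positivity) (hc.intervalIntegrable _ _)
      linarith
    nlinarith [sq_nonneg (deriv f t)]
  have h := intervalIntegral.integral_mono_on (μ := volume) hs.le
    (continuous_const.intervalIntegrable _ _)
    ((hc.fun_add continuous_const).intervalIntegrable 0 s) key
  rw [intervalIntegral.integral_const,
    intervalIntegral.integral_add (μ := volume) (hc.intervalIntegrable _ _)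
    (continuous_const.intervalIntegrable _ _), intervalIntegral.integral_const, ← hI] at h
  simp only [sub_zero, smul_eq_mul] at h
  linarith

/-- The preceding estimate divided by `s`, in extended nonnegative form so that Tonelli applies
later without integrability conditions. -/
theorem enorm_sq_le_lintegral_of_contDiff {f : ℝ → ℝ} (hf : ContDiff ℝ 1 f) {s : ℝ}
    (hs : 0 < s) : ‖f 0‖ₑ ^ 2 ≤
      ENNReal.ofReal (1 / s + 1) * ∫⁻ t in Set.Ioc 0 s, (‖f t‖ₑ ^ 2 + ‖deriv f t‖ₑ ^ 2) := by
  have hd : Continuous (deriv f) := hf.continuous_deriv le_rfl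
  have hf0 : Continuous f := hf.continuous
  have hc : Continuous fun t => f t ^ 2 + deriv f t ^ 2 := by fun_prop
  have h0 : ∀ x : ℝ, ‖x‖ₑ ^ 2 = ENNReal.ofReal (x ^ 2) := fun x => by
    rw [Real.enorm_eq_ofReal_abs, ← ENNReal.ofReal_pow (abs_nonneg _), sq_abs]
  have h1 : ∫⁻ t in Set.Ioc 0 s, (‖f t‖ₑ ^ 2 + ‖deriv f t‖ₑ ^ 2) =
      ENNReal.ofReal (∫ t in (0)..s, (f t ^ 2 + deriv f t ^ 2)) := by
    rw [intervalIntegral.integral_of_le hs.le, ofReal_integral_eq_lintegral_ofReal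
      (hc.integrableOn_Ioc) (Eventually.of_forall fun x => by positivity)]
    refine lintegral_congr fun t => ?_
    rw [h0, h0, ENNReal.ofReal_add (by positivity) (by positivity)]
  rw [h1, h0, ← ENNReal.ofReal_mul (by positivity)]
  refine ENNReal.ofReal_le_ofReal ?_
  have h2 := sq_le_integral_of_contDiff hf hs
  rw [← mul_le_mul_iff_right₀ hs]
  refine h2.trans_eq ?_
  field_simp

/-- Integration over `ℝⁿ` by slices in the direction of the unit vector `e`. -/
theorem lintegral_slices {e : E n} (he : ‖e‖ = 1) {F : E n → ℝ≥0∞} (hF : Measurable F) :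
    ∫⁻ y : (ℝ ∙ e)ᗮ, ∫⁻ t : ℝ, F ((y : E n) + t • e) = ∫⁻ x, F x := by
  have h1 := (ℝ ∙ e).measurePreserving_measurableEquivProd (0 : E n)
  rw [InnerProductSpace.euclideanHausdorffMeasure_eq_volume] at h1
  rw [← h1.symm.lintegral_comp hF, Measure.volume_eq_prod, lintegral_prod_symm' _ (by fun_prop)]
  refine lintegral_congr fun y => ?_
  have h2 := (LinearIsometryEquiv.toSpanUnitSingleton (𝕜 := ℝ) e he).measurePreserving
  rw [← h2.lintegral_comp (f := fun z => F (((ℝ ∙ e).measurableEquivProd (0 : E n)).symm (z, y)))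
    (by fun_prop)]
  refine lintegral_congr fun t => ?_
  simp [add_comm]

/-- The energy density `|φ|² + |∇φ|²`. -/
noncomputable def energyDensity (φ : E n → ℝ) (x : E n) : ℝ≥0∞ := ‖φ x‖ₑ ^ 2 + ‖gradient φ x‖ₑ ^ 2

theorem continuous_gradient {φ : E n → ℝ} (hφ : ContDiff ℝ ∞ φ) : Continuous (gradient φ) :=
  (InnerProductSpace.toDual ℝ (E n)).symm.continuous.comp (hφ.continuous_fderiv (by simp))

theorem measurable_energyDensity {φ : E n → ℝ} (hφ : ContDiff ℝ ∞ φ) :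
    Measurable (energyDensity φ) := by
  have := (continuous_gradient hφ).measurable
  have := hφ.continuous.measurable
  unfold energyDensity
  fun_prop

/-- Along a segment of length `s` in the direction of a unit vector, the value at the base point is
controlled by the energy. -/
theorem enorm_sq_le_lintegral_energyDensity {φ : E n → ℝ} (hφ : ContDiff ℝ ∞ φ) {e : E n}
    (he : ‖e‖ = 1) {s : ℝ} (hs : 0 < s) (x : E n) :
    ‖φ x‖ₑ ^ 2 ≤ ENNReal.ofReal (1 / s + 1) *
      ∫⁻ t in Set.Ioc 0 s, energyDensity φ (x + t • e) := by
  have hf : ContDiff ℝ 1 fun t : ℝ => φ (x + t • e) :=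
    (hφ.of_le (by exact_mod_cast le_top)).comp (by fun_prop)
  have h := enorm_sq_le_lintegral_of_contDiff hf hs
  simp only [zero_smul, add_zero] at h
  refine h.trans ?_
  gcongr with t
  have h1 : HasDerivAt (fun t : ℝ => φ (x + t • e)) (fderiv ℝ φ (x + t • e) e) t := by
    refine ((hφ.differentiable (by simp)) (x + t • e)).hasFDerivAt.comp_hasDerivAt t ?_
    simpa using ((hasDerivAt_id t).smul_const e).const_add x
  rw [h1.deriv, ← inner_gradient_left, energyDensity]
  gcongr
  rw [enorm_le_iff_norm_le]
  simpa [he] using norm_inner_le_norm (𝕜 := ℝ) (gradient φ (x + t • e)) e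

/-- Strictly above the graph a point of the ball would lie in the open set `Ω`; strictly below it
would have a neighbourhood disjoint from `Ω`. Neither is possible on the boundary. -/
theorem eq_of_mem_frontier_chart (hΩ : IsOpen Ω) {p e : E n} {g : E n → ℝ} (hg : Continuous g)
    {r : ℝ} (hc : ∀ x ∈ Metric.ball p r, x ∈ Ω ↔ g (x - inner ℝ x e • e) < inner ℝ x e)
    {x : E n} (hx : x ∈ frontier Ω) (hxr : x ∈ Metric.ball p r) :
    g (x - inner ℝ x e • e) = inner ℝ x e := by
  rw [hΩ.frontier_eq] at hx
  refine le_antisymm ?_ (not_lt.1 fun h => hx.2 ((hc x hxr).2 h))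
  by_contra! h
  have ho : IsOpen {z : E n | inner ℝ z e < g (z - inner ℝ z e • e)} :=
    isOpen_lt (by fun_prop) (by fun_prop)
  obtain ⟨z, ⟨hz1, hz2⟩, hz3⟩ := mem_closure_iff.1 hx.1 _ (ho.inter Metric.isOpen_ball) ⟨h, hxr⟩
  exact lt_asymm hz1 ((hc z hz2).1 hz3)

/-- The trace inequality on the part of the boundary in a chart. -/
theorem lintegral_frontier_chart_le (hΩ : IsOpen Ω) {p e : E n} (he : ‖e‖ = 1) {g : E n → ℝ}
    {L : NNReal} (hg : LipschitzWith L g) {r : ℝ} (hr : 0 < r)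
    (hc : ∀ x ∈ Metric.ball p r, x ∈ Ω ↔ g (x - inner ℝ x e • e) < inner ℝ x e) :
    ∃ C : NNReal, ∀ φ : E n → ℝ, ContDiff ℝ ∞ φ →
      ∫⁻ x in frontier Ω ∩ Metric.ball p (r / 2), ‖φ x‖ₑ ^ 2
        ∂(Measure.euclideanHausdorffMeasure (n - 1)) ≤ C * ∫⁻ x in Ω, energyDensity φ x := by
  set S := frontier Ω ∩ Metric.ball p (r / 2) with hSdef
  have hS : MeasurableSet S := isClosed_frontier.measurableSet.inter measurableSet_ball
  have hSr : S ⊆ Metric.ball p r :=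
    Set.inter_subset_right.trans (Metric.ball_subset_ball (by linarith))
  have hl := lipschitzWith_graphMap he hg
  have hm : Measurable (graphMap e g) := hl.continuous.measurable
  have hSg : S ⊆ Set.range (graphMap e g) := by
    intro x hx
    have h1 := eq_of_mem_frontier_chart hΩ hg.continuous hc hx.1 (hSr hx)
    refine ⟨⟨x - inner ℝ x e • e, ?_⟩, ?_⟩
    · rw [Submodule.mem_orthogonal_singleton_iff_inner_left, inner_sub_left, real_inner_smul_left,
        real_inner_self_eq_norm_sq, he]
      ring
    · simp only [graphMap, h1]
      abel
  -- A segment of length `r / 2` from a point of the half ball stays in the full ball, where the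
  -- chart is valid, and above the graph.
  have hin : ∀ y : (ℝ ∙ e)ᗮ, graphMap e g y ∈ S → ∀ t ∈ Set.Ioc 0 (r / 2),
      (y : E n) + (t + g y) • e ∈ Ω := by
    intro y hy t ht
    have h1 : (y : E n) + (t + g y) • e = graphMap e g y + t • e := by
      simp only [graphMap, add_smul]; abel
    rw [hc]
    · rw [inner_add_smul_unit he, add_sub_cancel_right]
      linarith [ht.1]
    · rw [h1, Metric.mem_ball]
      have h2 := Metric.mem_ball.1 hy.2
      have h3 : dist (graphMap e g y + t • e) (graphMap e g y) = t := by
        rw [dist_eq_norm, add_sub_cancel_left, norm_smul, he, mul_one, Real.norm_of_nonneg ht.1.le]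
      linarith [dist_triangle (graphMap e g y + t • e) (graphMap e g y) p, ht.2]
  -- The area distortion of the graph map times the constant of the segment estimate with `s = r /
  -- 2`.
  refine ⟨(1 + L) ^ (n - 1) * (1 / (r / 2) + 1).toNNReal, fun φ hφ => ?_⟩
  have hmφ : Measurable fun x => ‖φ x‖ₑ ^ 2 := by
    have := hφ.continuous.measurable
    fun_prop
  have hme := measurable_energyDensity hφ
  refine (lintegral_mono' (restrict_le_map_graphMap he hg hSg) le_rfl).trans ?_
  rw [lintegral_smul_measure, lintegral_map hmφ hm, smul_eq_mul]
  push_cast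
  rw [mul_assoc]
  gcongr
  calc ∫⁻ y in graphMap e g ⁻¹' S, ‖φ (graphMap e g y)‖ₑ ^ 2
      ≤ ∫⁻ y in graphMap e g ⁻¹' S, ENNReal.ofReal (1 / (r / 2) + 1) *
          ∫⁻ t, Ω.indicator (energyDensity φ) ((y : E n) + t • e) := by
        refine setLIntegral_mono' (hm hS) fun y hy => ?_
        refine (enorm_sq_le_lintegral_energyDensity hφ he (half_pos hr) _).trans
          (mul_le_mul' le_rfl ?_)
        -- Translating `t` by `g y` turns the segment above the graph into part of the full vertical
        -- line over `y`.
        rw [← lintegral_add_right_eq_self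
          (fun t => Ω.indicator (energyDensity φ) ((y : E n) + t • e)) (g y)]
        refine le_trans (setLIntegral_mono' measurableSet_Ioc fun t ht => ?_)
          (setLIntegral_le_lintegral _ _)
        rw [Set.indicator_of_mem (hin y hy t ht), graphMap, add_smul, add_assoc,
          add_comm (t • e)]
    _ ≤ ∫⁻ y : (ℝ ∙ e)ᗮ, ENNReal.ofReal (1 / (r / 2) + 1) *
          ∫⁻ t, Ω.indicator (energyDensity φ) ((y : E n) + t • e) :=
        setLIntegral_le_lintegral _ _
    _ = ENNReal.ofReal (1 / (r / 2) + 1) * ∫⁻ x in Ω, energyDensity φ x := by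
        rw [lintegral_const_mul' _ _ ENNReal.ofReal_ne_top,
          lintegral_slices he (hme.indicator hΩ.measurableSet),
          lintegral_indicator hΩ.measurableSet]

/-- The trace inequality for smooth functions. -/
theorem exists_lintegral_surf_le (hΩ : IsBoundedLipschitzDomain Ω) :
    ∃ C : NNReal, ∀ φ : E n → ℝ, ContDiff ℝ ∞ φ →
      ∫⁻ x, ‖φ x‖ₑ ^ 2 ∂(surf Ω) ≤ C * ∫⁻ x in Ω, energyDensity φ x := by
  have hK : IsCompact (frontier Ω) :=
    Metric.isCompact_of_isClosed_isBounded isClosed_frontier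
      (hΩ.isBounded.closure.subset frontier_subset_closure)
  refine hK.induction_on (p := fun S => ∃ C : NNReal, ∀ φ : E n → ℝ, ContDiff ℝ ∞ φ →
      ∫⁻ x in S, ‖φ x‖ₑ ^ 2 ∂(Measure.euclideanHausdorffMeasure (n - 1)) ≤
        C * ∫⁻ x in Ω, energyDensity φ x) ⟨0, by simp⟩ ?_ ?_ ?_
  · rintro s t hst ⟨C, hC⟩
    exact ⟨C, fun φ hφ => (lintegral_mono_set hst).trans (hC φ hφ)⟩
  · rintro s t ⟨C, hC⟩ ⟨C', hC'⟩
    refine ⟨C + C', fun φ hφ => (lintegral_union_le _ _ _).trans ?_⟩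
    push_cast
    rw [add_mul]
    exact add_le_add (hC φ hφ) (hC' φ hφ)
  · intro p hp
    obtain ⟨e, g, L, r, he, hg, hr, hc⟩ := hΩ.lipschitz_boundary p hp
    exact ⟨_, inter_mem_nhdsWithin _ (Metric.ball_mem_nhds p (half_pos hr)),
      lintegral_frontier_chart_le hΩ.isOpen he hg hr hc⟩

/-- Square roots are avoided: `C ≤ (C + 1)²` and `a² + b² ≤ (a + b)²` suffice. -/
theorem exists_eLpNorm_surf_le (hΩ : IsBoundedLipschitzDomain Ω) :
    ∃ C : NNReal, ∀ φ : E n → ℝ, ContDiff ℝ ∞ φ → eLpNorm φ 2 (surf Ω) ≤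
      C * (eLpNorm φ 2 (vol Ω) + eLpNorm (gradient φ) 2 (vol Ω)) := by
  obtain ⟨C, hC⟩ := exists_lintegral_surf_le hΩ
  refine ⟨C + 1, fun φ hφ => ?_⟩
  have h1 : ∫⁻ x in Ω, energyDensity φ x =
      eLpNorm φ 2 (vol Ω) ^ 2 + eLpNorm (gradient φ) 2 (vol Ω) ^ 2 := by
    rw [eLpNorm_two_sq, eLpNorm_two_sq, ← lintegral_add_left]
    · rfl
    · have := hφ.continuous.measurable
      fun_prop
  have h2 := hC φ hφ
  rw [← eLpNorm_two_sq, h1] at h2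
  rw [← ENNReal.pow_le_pow_left_iff two_ne_zero]
  refine h2.trans ?_
  rw [mul_pow]
  push_cast
  gcongr
  · calc (C : ℝ≥0∞) ≤ (C + 1) ^ 1 := by rw [pow_one]; exact le_self_add
      _ ≤ (C + 1) ^ 2 := pow_le_pow_right₀ le_add_self (by norm_num)
  · rw [add_sq]
    gcongr
    exact le_self_add

/-- The smooth estimate passes to the limit along the sequence defining the trace. It holds for
every trace, not just the chosen one, and so applies to differences while existence is still being
proved. -/
theorem norm_le_of_isTrace {C : NNReal} (hC : ∀ φ : E n → ℝ, ContDiff ℝ ∞ φ →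
    eLpNorm φ 2 (surf Ω) ≤ C * (eLpNorm φ 2 (vol Ω) + eLpNorm (gradient φ) 2 (vol Ω)))
    {u : H1 Ω} {g : Lp ℝ 2 (surf Ω)} (hg : IsTrace Ω u g) :
    ‖g‖ ≤ C * (‖val Ω u‖ + ‖grad Ω u‖) := by
  obtain ⟨φ, hφ, h1, h2, h3⟩ := hg
  have hm1 : ∀ m, AEStronglyMeasurable (fun x => φ m x - val Ω u x) (vol Ω) := fun m =>
    (hφ m).continuous.aestronglyMeasurable.sub (Lp.aestronglyMeasurable _)
  have hm2 : ∀ m, AEStronglyMeasurable (fun x => gradient (φ m) x - grad Ω u x) (vol Ω) :=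
    fun m => (continuous_gradient (hφ m)).aestronglyMeasurable.sub (Lp.aestronglyMeasurable _)
  have hm3 : ∀ m, AEStronglyMeasurable (fun x => φ m x - g x) (surf Ω) := fun m =>
    (hφ m).continuous.aestronglyMeasurable.sub (Lp.aestronglyMeasurable _)
  have key : ∀ m, eLpNorm g 2 (surf Ω) ≤ eLpNorm (fun x => φ m x - g x) 2 (surf Ω) +
      C * ((eLpNorm (fun x => φ m x - val Ω u x) 2 (vol Ω) + eLpNorm (val Ω u) 2 (vol Ω)) +
        (eLpNorm (fun x => gradient (φ m) x - grad Ω u x) 2 (vol Ω) +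
          eLpNorm (grad Ω u) 2 (vol Ω))) := by
    intro m
    have e1 : (g : E n → ℝ) = φ m - fun x => φ m x - g x := by ext x; simp
    have e2 : φ m = (fun x => φ m x - val Ω u x) + (val Ω u : E n → ℝ) := by ext x; simp
    have e3 : gradient (φ m) = (fun x => gradient (φ m) x - grad Ω u x) +
      (grad Ω u : E n → E n) := by ext x; simp
    calc eLpNorm g 2 (surf Ω) = eLpNorm (φ m - fun x => φ m x - g x) 2 (surf Ω) := by rw [← e1]
      _ ≤ eLpNorm (φ m) 2 (surf Ω) + eLpNorm (fun x => φ m x - g x) 2 (surf Ω) :=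
        eLpNorm_sub_le (hφ m).continuous.aestronglyMeasurable (hm3 m) (by norm_num)
      _ ≤ C * (eLpNorm (φ m) 2 (vol Ω) + eLpNorm (gradient (φ m)) 2 (vol Ω)) +
          eLpNorm (fun x => φ m x - g x) 2 (surf Ω) := by gcongr; exact hC _ (hφ m)
      _ ≤ _ := by
        rw [add_comm]
        gcongr
        · conv_lhs => rw [e2]
          exact eLpNorm_add_le (hm1 m) (Lp.aestronglyMeasurable _) (by norm_num)
        · conv_lhs => rw [e3]
          exact eLpNorm_add_le (hm2 m) (Lp.aestronglyMeasurable _) (by norm_num)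
  have hlim := h3.add (ENNReal.Tendsto.const_mul (a := (C : ℝ≥0∞))
    ((h1.add_const (eLpNorm (val Ω u) 2 (vol Ω))).add
      (h2.add_const (eLpNorm (grad Ω u) 2 (vol Ω)))) (Or.inr ENNReal.coe_ne_top))
  have hle := ge_of_tendsto' hlim key
  simp only [zero_add] at hle
  rw [Lp.norm_def, Lp.norm_def, Lp.norm_def, ← ENNReal.toReal_add (Lp.eLpNorm_ne_top _)
    (Lp.eLpNorm_ne_top _), ← ENNReal.coe_toReal, ← ENNReal.toReal_mul]
  refine ENNReal.toReal_mono ?_ hle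
  exact ENNReal.mul_ne_top ENNReal.coe_ne_top
    (ENNReal.add_ne_top.2 ⟨Lp.eLpNorm_ne_top _, Lp.eLpNorm_ne_top _⟩)

theorem norm_sq_eq (u : H1 Ω) : ‖u‖ ^ 2 = ‖val Ω u‖ ^ 2 + ‖grad Ω u‖ ^ 2 :=
  WithLp.prod_norm_sq_eq_of_L2 (u : WithLp 2 (Lp ℝ 2 (vol Ω) × Lp (E n) 2 (vol Ω)))

theorem norm_val_le (u : H1 Ω) : ‖val Ω u‖ ≤ ‖u‖ :=
  abs_le_of_sq_le_sq' (by rw [norm_sq_eq u]; nlinarith [sq_nonneg ‖grad Ω u‖]) (norm_nonneg _) |>.2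

theorem norm_grad_le (u : H1 Ω) : ‖grad Ω u‖ ≤ ‖u‖ :=
  abs_le_of_sq_le_sq' (by rw [norm_sq_eq u]; nlinarith [sq_nonneg ‖val Ω u‖]) (norm_nonneg _) |>.2

theorem norm_le_add (u : H1 Ω) : ‖u‖ ≤ ‖val Ω u‖ + ‖grad Ω u‖ := by
  refine (abs_le_of_sq_le_sq' ?_ (by positivity)).2
  rw [norm_sq_eq u]
  nlinarith [norm_nonneg (val Ω u), norm_nonneg (grad Ω u)]

/-! ### Mollification with off-centre kernels -/

/-- A smooth averaging kernel with compact support. -/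
structure IsKernel (k : E n → ℝ) : Prop where
  contDiff : ContDiff ℝ ∞ k
  hasCompactSupport : HasCompactSupport k
  nonneg : ∀ z, 0 ≤ k z
  integral_eq_one : ∫ z, k z = 1

section

variable {F : Type*} [NormedAddCommGroup F]

/-- Continuity of translations in `L²`, obtained from continuity of composition with measure
preserving maps. -/
theorem exists_eLpNorm_translate_sub_le {f : E n → F} (hf : MemLp f 2 volume) {ε : ℝ}
    (hε : 0 < ε) : ∃ δ > 0, ∀ z : E n, ‖z‖ < δ →
      eLpNorm (fun x => f (x - z) - f x) 2 volume ≤ ENNReal.ofReal ε := by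
  let T : E n → C(E n, E n) := fun z => ⟨fun x => x - z, by fun_prop⟩
  have hT : Continuous T :=
    (ContinuousMap.curry ⟨fun q : E n × E n => q.2 - q.1, by fun_prop⟩).continuous
  have hTm : ∀ z, MeasurePreserving (T z) volume volume := fun z => measurePreserving_sub_right _ z
  have hcont := (continuous_const (y := hf.toLp f)).compMeasurePreservingLp hT hTm (by norm_num)
  obtain ⟨δ, hδ, h⟩ := Metric.continuousAt_iff.1 (hcont.continuousAt (x := 0)) ε hε
  refine ⟨δ, hδ, fun z hz => ?_⟩
  have h1 := (h (show dist z 0 < δ by simpa using hz)).le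
  rw [Lp.toLp_compMeasurePreserving hf (hTm z), Lp.toLp_compMeasurePreserving hf (hTm 0),
    ← ENNReal.ofReal_le_ofReal_iff hε.le, ← edist_dist, Lp.edist_toLp_toLp] at h1
  refine le_of_eq_of_le ?_ h1
  congr 1
  ext x
  simp [T]

theorem IsKernel.integrable_smul [NormedSpace ℝ F] {k : E n → ℝ} (hk : IsKernel k) {f : E n → F}
    (hf : LocallyIntegrable f volume) (x : E n) : Integrable (fun z => k z • f (x - z)) :=
  hk.hasCompactSupport.convolutionExists_left (lsmul ℝ ℝ) hk.contDiff.continuous hf x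

/-- Since `k` has integral one, the difference is the mean of `f (x - z) - f x` for the probability
measure `k dz`, and the `L¹` norm is at most the `L²` norm there. -/
theorem IsKernel.enorm_convolution_sub_sq_le [NormedSpace ℝ F] [CompleteSpace F] {k : E n → ℝ}
    (hk : IsKernel k) {f : E n → F} (hfm : StronglyMeasurable f) (hf : LocallyIntegrable f volume)
    (x : E n) : ‖(k ⋆[lsmul ℝ ℝ, volume] f) x - f x‖ₑ ^ 2 ≤
      ∫⁻ z, ENNReal.ofReal (k z) * ‖f (x - z) - f x‖ₑ ^ 2 := by
  have hkc := hk.contDiff.continuous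
  have hki : Integrable k := hkc.integrable_of_hasCompactSupport hk.hasCompactSupport
  set ν : Measure (E n) := volume.withDensity fun z => ENNReal.ofReal (k z) with hν
  have hkm : Measurable fun z => ENNReal.ofReal (k z) := hkc.measurable.ennreal_ofReal
  have : IsProbabilityMeasure ν := ⟨by
    rw [hν, withDensity_apply _ .univ, setLIntegral_univ, ← ofReal_integral_eq_lintegral_ofReal hki
      (Eventually.of_forall hk.nonneg), hk.integral_eq_one, ENNReal.ofReal_one]⟩
  have hm : StronglyMeasurable fun z => f (x - z) - f x :=
    (hfm.comp_measurable (by fun_prop)).sub stronglyMeasurable_const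
  have h1 : (k ⋆[lsmul ℝ ℝ, volume] f) x - f x = ∫ z, k z • (f (x - z) - f x) := by
    simp_rw [smul_sub]
    rw [integral_sub (hk.integrable_smul hf x) (hki.smul_const _), integral_smul_const,
      hk.integral_eq_one, one_smul]
    rfl
  have h2 : ‖(k ⋆[lsmul ℝ ℝ, volume] f) x - f x‖ₑ ≤ eLpNorm (fun z => f (x - z) - f x) 1 ν := by
    rw [h1, eLpNorm_one_eq_lintegral_enorm, hν, lintegral_withDensity_eq_lintegral_mul _ hkm
      hm.enorm]
    refine (enorm_integral_le_lintegral_enorm _).trans_eq (lintegral_congr fun z => ?_)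
    rw [enorm_smul, Real.enorm_of_nonneg (hk.nonneg z)]
    rfl
  calc _ ≤ eLpNorm (fun z => f (x - z) - f x) 2 ν ^ 2 := by
        gcongr
        exact h2.trans (eLpNorm_le_eLpNorm_of_exponent_le (by norm_num) hm.aestronglyMeasurable)
    _ = _ := by
        rw [eLpNorm_two_sq, hν, lintegral_withDensity_eq_lintegral_mul _ hkm (hm.enorm.pow_const 2)]
        rfl

/-- Integrating the pointwise bound in `x` and exchanging integrals averages squared translation
errors, each at most `B²` on the support of `k`. -/
theorem IsKernel.eLpNorm_convolution_sub_le [NormedSpace ℝ F] [CompleteSpace F] {k : E n → ℝ}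
    (hk : IsKernel k) {f : E n → F} (hfm : StronglyMeasurable f) (hf : LocallyIntegrable f volume)
    {B : ℝ≥0∞} (hB : ∀ z ∈ tsupport k, eLpNorm (fun x => f (x - z) - f x) 2 volume ≤ B) :
    eLpNorm (fun x => (k ⋆[lsmul ℝ ℝ, volume] f) x - f x) 2 volume ≤ B := by
  have hkc := hk.contDiff.continuous
  have hki : Integrable k := hkc.integrable_of_hasCompactSupport hk.hasCompactSupport
  rw [← ENNReal.pow_le_pow_left_iff two_ne_zero, eLpNorm_two_sq]
  have hm : Measurable fun q : E n × E n =>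
      ENNReal.ofReal (k q.2) * ‖f (q.1 - q.2) - f q.1‖ₑ ^ 2 := by
    have h1 : StronglyMeasurable fun q : E n × E n => f (q.1 - q.2) - f q.1 :=
      (hfm.comp_measurable (by fun_prop)).sub (hfm.comp_measurable (by fun_prop))
    exact (hkc.measurable.comp measurable_snd).ennreal_ofReal.mul (h1.enorm.pow_const 2)
  calc _ ≤ ∫⁻ x, ∫⁻ z, ENNReal.ofReal (k z) * ‖f (x - z) - f x‖ₑ ^ 2 :=
        lintegral_mono fun x => hk.enorm_convolution_sub_sq_le hfm hf x
    _ = ∫⁻ z, ∫⁻ x, ENNReal.ofReal (k z) * ‖f (x - z) - f x‖ₑ ^ 2 :=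
        lintegral_lintegral_swap hm.aemeasurable
    _ ≤ ∫⁻ z, ENNReal.ofReal (k z) * B ^ 2 := by
        refine lintegral_mono fun z => ?_
        rw [lintegral_const_mul' _ _ ENNReal.ofReal_ne_top]
        by_cases hz : z ∈ tsupport k
        · rw [← eLpNorm_two_sq]
          gcongr
          exact hB z hz
        · simp [image_eq_zero_of_notMem_tsupport hz]
    _ = B ^ 2 := by
        rw [lintegral_mul_const _ hkc.measurable.ennreal_ofReal,
          ← ofReal_integral_eq_lintegral_ofReal hki (Eventually.of_forall hk.nonneg),
          hk.integral_eq_one, ENNReal.ofReal_one, one_mul]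

end

theorem memLp_indicator {F : Type*} [NormedAddCommGroup F] (hΩ : MeasurableSet Ω)
    (f : Lp F 2 (vol Ω)) : MemLp (Ω.indicator f) 2 volume :=
  (memLp_indicator_iff_restrict hΩ).2 (Lp.memLp f)

/-- The convolution of the extension by zero is smooth. -/
theorem IsKernel.contDiff_convolution {k : E n → ℝ} (hk : IsKernel k) {f : E n → ℝ}
    (hf : LocallyIntegrable f volume) : ContDiff ℝ ∞ (k ⋆[lsmul ℝ ℝ, volume] f) :=
  hk.hasCompactSupport.contDiff_convolution_left _ hk.contDiff hf

theorem IsKernel.fderiv_convolution_apply (hΩ : MeasurableSet Ω) {u : E n → ℝ}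
    (hu : LocallyIntegrable (Ω.indicator u) volume) {k : E n → ℝ} (hk : IsKernel k) (x y : E n) :
    (convolution (fderiv ℝ k) (Ω.indicator u)
      ((lsmul ℝ ℝ : ℝ →L[ℝ] ℝ →L[ℝ] ℝ).precompL (E n)) volume x) y =
      ∫ t in Ω, u t * fderiv ℝ k (x - t) y := by
  have hfc : HasCompactSupport (fderiv ℝ k) := hk.hasCompactSupport.fderiv ℝ
  have hi : Integrable fun t => ((lsmul ℝ ℝ : ℝ →L[ℝ] ℝ →L[ℝ] ℝ).precompL (E n))
      (fderiv ℝ k t) (Ω.indicator u (x - t)) :=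
    hfc.convolutionExists_left _ (hk.contDiff.continuous_fderiv (by simp)) hu x
  rw [convolution_def, ContinuousLinearMap.integral_apply hi,
    ← integral_sub_left_eq_self _ volume x, ← integral_indicator hΩ]
  refine integral_congr_ae (Eventually.of_forall fun t => ?_)
  by_cases ht : t ∈ Ω
  · simp [ht, mul_comm]
  · simp [ht]

theorem IsKernel.inner_convolution (hΩ : MeasurableSet Ω) {G : E n → E n}
    (hG : LocallyIntegrable (Ω.indicator G) volume) {k : E n → ℝ} (hk : IsKernel k) (x y : E n) :
    inner ℝ ((k ⋆[lsmul ℝ ℝ, volume] Ω.indicator G) x) y =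
      ∫ t in Ω, inner ℝ (G t) y * k (x - t) := by
  rw [convolution_lsmul, real_inner_comm, ← integral_inner (hk.integrable_smul hG x),
    ← integral_sub_left_eq_self _ volume x, ← integral_indicator hΩ]
  refine integral_congr_ae (Eventually.of_forall fun t => ?_)
  by_cases ht : t ∈ Ω
  · simp [ht, inner_smul_right, mul_comm, real_inner_comm]
  · simp [ht]

/-- Where the kernel only sees points of `Ω`, the gradient of the convolution is the convolution of
the weak gradient. -/
theorem IsKernel.hasGradientAt_convolution (hΩ : MeasurableSet Ω) {u : E n → ℝ} {G : E n → E n}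
    (hw : IsWeakGradient Ω u G) (hu : LocallyIntegrable (Ω.indicator u) volume)
    (hG : LocallyIntegrable (Ω.indicator G) volume) {k : E n → ℝ}
    (hk : IsKernel k) {x : E n} (hx : ∀ z ∈ tsupport k, x - z ∈ Ω) :
    HasGradientAt (k ⋆[lsmul ℝ ℝ, volume] Ω.indicator u)
      ((k ⋆[lsmul ℝ ℝ, volume] Ω.indicator G) x) x := by
  have h := hk.hasCompactSupport.hasFDerivAt_convolution_left (lsmul ℝ ℝ)
    (hk.contDiff.of_le (by exact_mod_cast le_top)) hu x
  rw [hasGradientAt_iff_hasFDerivAt]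
  refine h.congr_fderiv (ContinuousLinearMap.ext fun y => ?_)
  rw [InnerProductSpace.toDual_apply_apply, hk.fderiv_convolution_apply hΩ hu,
    hk.inner_convolution hΩ hG]
  -- The reflected kernel is an admissible test function exactly because it sees only `Ω`; the sign
  -- from the reflection cancels the one in the definition of the weak gradient.
  let φ : E n → ℝ := fun t => k (x - t)
  have hφ : ContDiff ℝ ∞ φ := hk.contDiff.comp (by fun_prop)
  have hφc : HasCompactSupport φ := hk.hasCompactSupport.comp_homeomorph (Homeomorph.subLeft x)
  have hφs : tsupport φ ⊆ Ω := by
    have h1 : tsupport φ = Homeomorph.subLeft x ⁻¹' tsupport k :=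
      tsupport_comp_eq_preimage k (Homeomorph.subLeft x)
    intro t ht
    rw [h1] at ht
    simpa using hx _ ht
  have hd : ∀ t, fderiv ℝ k (x - t) y = - fderiv ℝ φ t y := by
    intro t
    have h1 : HasFDerivAt φ ((fderiv ℝ k (x - t)).comp (-ContinuousLinearMap.id ℝ (E n))) t :=
      ((hk.contDiff.differentiable (by simp)) (x - t)).hasFDerivAt.comp t
        ((hasFDerivAt_id t).const_sub x)
    rw [h1.fderiv]
    simp
  simp_rw [hd, mul_neg]
  rw [integral_neg, hw φ hφ hφc hφs y, neg_neg]

/-- Near each point of the closure of a Lipschitz domain there are kernels with arbitrarily small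
support that only see points of the domain. -/
theorem exists_isKernel (hΩ : IsBoundedLipschitzDomain Ω) {p : E n} (hp : p ∈ closure Ω) :
    ∃ ρ > 0, ∀ δ > 0, ∃ k : E n → ℝ, IsKernel k ∧ (∀ z ∈ tsupport k, ‖z‖ < δ) ∧
      ∀ x ∈ Ω ∩ Metric.ball p ρ, ∀ z ∈ tsupport k, x - z ∈ Ω := by
  have hbump : ∀ (a : E n) (s : ℝ), 0 < s → ∃ k : E n → ℝ, IsKernel k ∧
      tsupport k = Metric.closedBall a s := by
    intro a s hs
    let b : ContDiffBump a := ⟨s / 2, s, half_pos hs, half_lt_self hs⟩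
    exact ⟨b.normed volume, ⟨b.contDiff_normed, b.hasCompactSupport_normed,
      b.nonneg_normed, b.integral_normed⟩, b.tsupport_normed_eq⟩
  by_cases hpΩ : p ∈ Ω
  · obtain ⟨r, hr, hrΩ⟩ := Metric.isOpen_iff.1 hΩ.isOpen p hpΩ
    refine ⟨r / 2, by positivity, fun δ hδ => ?_⟩
    obtain ⟨k, hk, hks⟩ := hbump 0 (min δ (r / 2) / 2) (by positivity)
    have hz : ∀ z ∈ tsupport k, ‖z‖ < min δ (r / 2) := fun z hz => by
      rw [hks, mem_closedBall_zero_iff] at hz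
      have : 0 < min δ (r / 2) := by positivity
      linarith
    refine ⟨k, hk, fun z h => (hz z h).trans_le (min_le_left _ _), fun x hx z h => hrΩ ?_⟩
    have h1 := (hz z h).trans_le (min_le_right _ _)
    have h2 := Metric.mem_ball.1 hx.2
    rw [Metric.mem_ball]
    have h3 : dist (x - z) x = ‖z‖ := by rw [dist_eq_norm]; simp
    linarith [dist_triangle (x - z) x p]
  · have hpf : p ∈ frontier Ω := by rw [hΩ.isOpen.frontier_eq]; exact ⟨hp, hpΩ⟩
    obtain ⟨e, g, L, r, he, hg, hr, hc⟩ := hΩ.lipschitz_boundary p hpf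
    refine ⟨r / 2, by positivity, fun δ hδ => ?_⟩
    -- The kernel is centred at `-τ e`, so `x - z` is `x` pushed up by `τ` with an error `w`. This
    -- error costs at most `‖w‖` in height and `L ‖w‖` in the graph function, whence the radius `τ /
    -- (1 + L)`. The divisor `3` gives `‖z‖ ≤ 2 τ < min δ (r / 2)`.
    set τ := min δ (r / 2) / 3 with hτ
    have hm0 : 0 < min δ (r / 2) := by positivity
    have hτ0 : 0 < τ := by positivity
    have hL : (0 : ℝ) ≤ L := L.2
    obtain ⟨k, hk, hks⟩ := hbump (-(τ • e)) (τ / (1 + L)) (by positivity)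
    have hle : τ / (1 + L) ≤ τ := div_le_self hτ0.le (by linarith)
    have hw : ∀ z ∈ tsupport k, ‖z + τ • e‖ ≤ τ / (1 + L) := fun z hz => by
      rw [hks, Metric.mem_closedBall, dist_eq_norm, sub_neg_eq_add] at hz
      exact hz
    have hz : ∀ z ∈ tsupport k, ‖z‖ < min δ (r / 2) := fun z hz => by
      have h1 : ‖z‖ ≤ ‖z + τ • e‖ + ‖τ • e‖ := by
        simpa using norm_sub_le (z + τ • e) (τ • e)
      rw [norm_smul, he, mul_one, Real.norm_of_nonneg hτ0.le] at h1
      have := hw z hz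
      linarith
    refine ⟨k, hk, fun z h => (hz z h).trans_le (min_le_left _ _), fun x hx z h => ?_⟩
    have h1 := (hz z h).trans_le (min_le_right _ _)
    have h2 := Metric.mem_ball.1 hx.2
    have h3 : dist (x - z) x = ‖z‖ := by rw [dist_eq_norm]; simp
    have hxr : x ∈ Metric.ball p r := Metric.ball_subset_ball (by linarith) hx.2
    rw [hc _ (by rw [Metric.mem_ball]; linarith [dist_triangle (x - z) x p])]
    have h4 := (hc x hxr).1 hx.1
    have hee : inner ℝ e e = (1 : ℝ) := by rw [real_inner_self_eq_norm_sq, he]; norm_num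
    set w := z + τ • e with hwdef
    have h5 : x - z = x + τ • e - w := by rw [hwdef]; abel
    have h6 : inner ℝ (x - z) e = inner ℝ x e + τ - inner ℝ w e := by
      rw [h5, inner_sub_left, inner_add_left, real_inner_smul_left, hee, mul_one]
    have h7 : |inner ℝ w e| ≤ ‖w‖ := by simpa [he] using abs_real_inner_le_norm w e
    have h8 : ‖w - inner ℝ w e • e‖ ≤ ‖w‖ := by
      refine (abs_le_of_sq_le_sq' ?_ (norm_nonneg _)).2
      rw [norm_sub_sq_real, real_inner_smul_right, norm_smul, he, Real.norm_eq_abs, mul_one, sq_abs]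
      nlinarith [sq_nonneg (inner ℝ w e)]
    have h9 := hg.dist_le_mul (x - z - inner ℝ (x - z) e • e) (x - inner ℝ x e • e)
    have h10 : x - z - inner ℝ (x - z) e • e - (x - inner ℝ x e • e) =
        -(w - inner ℝ w e • e) := by
      rw [h6, h5]
      module
    rw [dist_eq_norm, dist_eq_norm, h10, norm_neg, Real.norm_eq_abs] at h9
    have h11 := (le_abs_self _).trans h9
    have h12 : (L : ℝ) * ‖w - inner ℝ w e • e‖ + ‖w‖ ≤ τ := by
      have h13 : (1 + (L : ℝ)) * ‖w‖ ≤ τ := by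
        have := hw z h
        rwa [le_div_iff₀ (by positivity), mul_comm] at this
      nlinarith
    linarith [le_abs_self (inner ℝ w e)]

/-! ### Density of `H²(Ω)` in `H¹(Ω)` -/

theorem memLp_of_continuous {F : Type*} [NormedAddCommGroup F] [SecondCountableTopology F]
    (hΩb : Bornology.IsBounded Ω) {f : E n → F} (hf : Continuous f) : MemLp f 2 (vol Ω) := by
  have hK : IsCompact (closure Ω) := hΩb.isCompact_closure
  have : IsFiniteMeasure ((volume : Measure (E n)).restrict (closure Ω)) :=
    ⟨by simpa using hK.measure_lt_top⟩
  obtain ⟨C, hC⟩ := hK.exists_bound_of_continuousOn hf.continuousOn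
  refine (MemLp.of_bound (μ := (volume : Measure (E n)).restrict (closure Ω))
    hf.aestronglyMeasurable C ?_).mono_measure (Measure.restrict_mono_set _ subset_closure)
  exact (ae_restrict_iff' isClosed_closure.measurableSet).2 (Eventually.of_forall hC)

/-- The test function is supported in `Ω`, so the integrals extend to the whole space and
integration by parts has no boundary term. -/
theorem isWeakGradient_of_contDiff {v : E n → ℝ} (hv : ContDiff ℝ ∞ v) :
    IsWeakGradient Ω v (gradient v) := by
  intro φ hφ hc hs y
  have h0 : ∀ f : E n → ℝ, (∀ x ∉ tsupport φ, f x = 0) → ∫ x in Ω, f x = ∫ x, f x := by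
    intro f hf
    refine setIntegral_eq_integral_of_forall_compl_eq_zero fun x hx => hf x fun h => hx (hs h)
  rw [h0 _ fun x hx => ?_, h0 _ fun x hx => ?_]
  · simp_rw [inner_gradient_left]
    have hvd : Continuous fun x => fderiv ℝ v x y :=
      (hv.continuous_fderiv (by simp)).clm_apply continuous_const
    exact integral_mul_fderiv_eq_neg_fderiv_mul_of_integrable
      ((hvd.mul hφ.continuous).integrable_of_hasCompactSupport hc.mul_left)
      ((hv.continuous.mul (continuous_test_deriv hφ y)).integrable_of_hasCompactSupport
        (hasCompactSupport_test_deriv hc y).mul_left)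
      ((hv.continuous.mul hφ.continuous).integrable_of_hasCompactSupport hc.mul_left)
      (fun x _ => hv.differentiable (by simp) x) (fun x _ => hφ.differentiable (by simp) x)
  · rw [image_eq_zero_of_notMem_tsupport hx, mul_zero]
  · rw [image_eq_zero_of_notMem_tsupport (fun h => hx (tsupport_fderiv_subset ℝ h))]
    simp

theorem IsWeakGradient.congr_ae {u v : E n → ℝ} {G H : E n → E n} (h : IsWeakGradient Ω u G)
    (huv : v =ᵐ[vol Ω] u) (hGH : H =ᵐ[vol Ω] G) : IsWeakGradient Ω v H := by
  intro φ hφ hc hs y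
  have h1 : ∫ x in Ω, v x * fderiv ℝ φ x y = ∫ x in Ω, u x * fderiv ℝ φ x y :=
    integral_congr_ae (huv.mono fun x hx => by simp only [hx])
  have h2 : ∫ x in Ω, inner ℝ (H x) y * φ x = ∫ x in Ω, inner ℝ (G x) y * φ x :=
    integral_congr_ae (hGH.mono fun x hx => by simp only [hx])
  rw [h1, h2, h φ hφ hc hs y]

/-- Smooth functions on `ℝⁿ` restrict to elements of `H¹(Ω)`. -/
theorem exists_H1_of_contDiff (hΩb : Bornology.IsBounded Ω) {v : E n → ℝ}
    (hv : ContDiff ℝ ∞ v) : ∃ w : H1 Ω, (val Ω w : E n → ℝ) =ᵐ[vol Ω] v ∧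
      (grad Ω w : E n → E n) =ᵐ[vol Ω] gradient v := by
  have h1 : MemLp v 2 (vol Ω) := memLp_of_continuous hΩb hv.continuous
  have h2 : MemLp (gradient v) 2 (vol Ω) := memLp_of_continuous hΩb (continuous_gradient hv)
  exact ⟨⟨WithLp.toLp 2 (h1.toLp v, h2.toLp _),
    (isWeakGradient_of_contDiff hv).congr_ae h1.coeFn_toLp h2.coeFn_toLp⟩,
    h1.coeFn_toLp, h2.coeFn_toLp⟩

/-- Smooth functions on `ℝⁿ` restrict to elements of `H²(Ω)`. -/
theorem exists_H2_of_contDiff (hΩb : Bornology.IsBounded Ω) {v : E n → ℝ}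
    (hv : ContDiff ℝ ∞ v) : ∃ w ∈ H2 Ω, (val Ω w : E n → ℝ) =ᵐ[vol Ω] v ∧
      (grad Ω w : E n → E n) =ᵐ[vol Ω] gradient v := by
  obtain ⟨w, hw1, hw2⟩ := exists_H1_of_contDiff hΩb hv
  refine ⟨w, fun i => ?_, hw1, hw2⟩
  have hd : ContDiff ℝ ∞ fun x => fderiv ℝ v x (EuclideanSpace.single i 1) :=
    (hv.fderiv_right (by simp)).clm_apply contDiff_const
  obtain ⟨z, hz, -⟩ := exists_H1_of_contDiff hΩb hd
  refine ⟨z, Lp.ext ?_⟩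
  have h1 : (dirDeriv Ω (EuclideanSpace.single i 1) w : E n → ℝ) =ᵐ[vol Ω]
      fun x => innerSL ℝ (EuclideanSpace.single i 1) (grad Ω w x) :=
    ContinuousLinearMap.coeFn_compLpL _ _
  filter_upwards [hz, h1, hw2] with x hx1 hx2 hx3
  rw [hx1, hx2, hx3, innerSL_apply_apply, real_inner_comm, inner_gradient_left]

theorem norm_sub_le_of_eLpNorm {u w : H1 Ω} {v : E n → ℝ} {H : E n → E n}
    (h1 : (val Ω w : E n → ℝ) =ᵐ[vol Ω] v) (h2 : (grad Ω w : E n → E n) =ᵐ[vol Ω] H)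
    {B : ℝ} (hB : 0 ≤ B)
    (h3 : eLpNorm (fun x => v x - val Ω u x) 2 (vol Ω) ≤ ENNReal.ofReal B)
    (h4 : eLpNorm (fun x => H x - grad Ω u x) 2 (vol Ω) ≤ ENNReal.ofReal B) :
    ‖w - u‖ ≤ B + B := by
  refine (norm_le_add _).trans (add_le_add ?_ ?_)
  · rw [map_sub, Lp.norm_def]
    refine ENNReal.toReal_le_of_le_ofReal hB (le_of_eq_of_le (eLpNorm_congr_ae ?_) h3)
    filter_upwards [h1, Lp.coeFn_sub (val Ω w) (val Ω u)] with x hx1 hx2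
    rw [hx2, Pi.sub_apply, hx1]
  · rw [map_sub, Lp.norm_def]
    refine ENNReal.toReal_le_of_le_ofReal hB (le_of_eq_of_le (eLpNorm_congr_ae ?_) h4)
    filter_upwards [h2, Lp.coeFn_sub (grad Ω w) (grad Ω u)] with x hx1 hx2
    rw [hx2, Pi.sub_apply, hx1]

/-- A smooth finite partition of unity on a compact set, subordinate to balls. -/
theorem exists_partition_of_unity {K : Set (E n)} (hK : IsCompact K) {ρ : E n → ℝ}
    (hρ : ∀ p ∈ K, 0 < ρ p) : ∃ (t : Finset (E n)) (η : E n → E n → ℝ), (∀ p ∈ t, p ∈ K) ∧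
      (∀ p, ContDiff ℝ ∞ (η p)) ∧ (∀ p ∈ t, tsupport (η p) ⊆ Metric.ball p (ρ p)) ∧
      (∀ p x, 0 ≤ η p x) ∧ (∀ p x, η p x ≤ 1) ∧ ∀ x ∈ K, ∑ p ∈ t, η p x = 1 := by
  obtain ⟨t, ht, htK⟩ := hK.elim_nhds_subcover (fun p => Metric.ball p (ρ p))
    fun p hp => Metric.ball_mem_nhds p (hρ p hp)
  obtain ⟨f, hf⟩ := SmoothPartitionOfUnity.exists_isSubordinate (modelWithCornersSelf ℝ (E n))
    hK.isClosed (fun p : t => Metric.ball (p : E n) (ρ p)) (fun _ => Metric.isOpen_ball)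
    (htK.trans (by simp [Set.iUnion_subtype]))
  classical
  refine ⟨t, fun p => if h : p ∈ t then f ⟨p, h⟩ else 0, ht, fun p => ?_, fun p hp => ?_,
    fun p x => ?_, fun p x => ?_, fun x hx => ?_⟩
  · dsimp only
    split_ifs with h
    · exact (f ⟨p, h⟩).contMDiff.contDiff
    · exact contDiff_const
  · simpa [hp] using hf ⟨p, hp⟩
  · dsimp only
    split_ifs with h
    · exact f.nonneg _ _
    · exact le_rfl
  · dsimp only
    split_ifs with h
    · exact f.le_one _ _
    · exact zero_le_one
  · have h1 := f.sum_eq_one hx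
    rw [finsum_eq_sum_of_fintype, ← Finset.sum_coe_sort t] at *
    refine Eq.trans (Finset.sum_congr rfl fun p _ => ?_) h1
    simp

theorem exists_norm_gradient_le {η : E n → ℝ} (hη : ContDiff ℝ ∞ η) {p : E n} {ρ : ℝ}
    (hs : tsupport η ⊆ Metric.ball p ρ) : ∃ C : NNReal, ∀ x, ‖gradient η x‖ ≤ C := by
  have hc : HasCompactSupport η :=
    Metric.isCompact_of_isClosed_isBounded (isClosed_tsupport _) (Metric.isBounded_ball.subset hs)
  obtain ⟨C, hC⟩ := (hη.continuous_fderiv (by simp)).bounded_above_of_compact_support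
    (hc.fderiv ℝ)
  refine ⟨C.toNNReal, fun x => ?_⟩
  rw [gradient, LinearIsometryEquiv.norm_map]
  exact (hC x).trans (Real.le_coe_toNNReal C)

/-- Local approximation: a smooth function close to `u` in `L²(Ω)` whose gradient is close to that
of `u` in the part of `Ω` in a ball. -/
theorem exists_local_approx (hΩ : MeasurableSet Ω) (u : H1 Ω) {p : E n} {ρ : ℝ}
    (hk : ∀ δ > 0, ∃ k : E n → ℝ, IsKernel k ∧ (∀ z ∈ tsupport k, ‖z‖ < δ) ∧
      ∀ x ∈ Ω ∩ Metric.ball p ρ, ∀ z ∈ tsupport k, x - z ∈ Ω) {ε : ℝ} (hε : 0 < ε) :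
    ∃ (v : E n → ℝ) (H : E n → E n), ContDiff ℝ ∞ v ∧ AEStronglyMeasurable H (vol Ω) ∧
      (∀ x ∈ Ω ∩ Metric.ball p ρ, HasGradientAt v (H x) x) ∧
      eLpNorm (fun x => v x - val Ω u x) 2 (vol Ω) ≤ ENNReal.ofReal ε ∧
      eLpNorm (fun x => H x - grad Ω u x) 2 (vol Ω) ≤ ENNReal.ofReal ε := by
  have hu := memLp_indicator hΩ (val Ω u)
  have hG := memLp_indicator hΩ (grad Ω u)
  have hul := hu.locallyIntegrable (by norm_num)
  have hGl := hG.locallyIntegrable (by norm_num)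
  obtain ⟨δ₁, hδ₁, h1⟩ := exists_eLpNorm_translate_sub_le hu hε
  obtain ⟨δ₂, hδ₂, h2⟩ := exists_eLpNorm_translate_sub_le hG hε
  obtain ⟨k, hk, hkδ, hkΩ⟩ := hk (min δ₁ δ₂) (lt_min hδ₁ hδ₂)
  have hcont : Continuous (k ⋆[lsmul ℝ ℝ, volume] Ω.indicator (grad Ω u)) :=
    hk.hasCompactSupport.continuous_convolution_left _ hk.contDiff.continuous hGl
  refine ⟨k ⋆[lsmul ℝ ℝ, volume] Ω.indicator (val Ω u),
    k ⋆[lsmul ℝ ℝ, volume] Ω.indicator (grad Ω u), hk.contDiff_convolution hul,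
    hcont.aestronglyMeasurable,
    fun x hx => hk.hasGradientAt_convolution hΩ u.2 hul hGl (hkΩ x hx), ?_, ?_⟩
  · have h3 := hk.eLpNorm_convolution_sub_le ((Lp.stronglyMeasurable (val Ω u)).indicator hΩ) hul
      fun z hz => h1 z ((hkδ z hz).trans_le (min_le_left _ _))
    refine le_trans (le_of_eq_of_le (eLpNorm_congr_ae ?_)
      (eLpNorm_mono_measure _ Measure.restrict_le_self)) h3
    filter_upwards [ae_restrict_mem hΩ] with x hx
    rw [Set.indicator_of_mem hx]
  · have h3 := hk.eLpNorm_convolution_sub_le ((Lp.stronglyMeasurable (grad Ω u)).indicator hΩ) hGl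
      fun z hz => h2 z ((hkδ z hz).trans_le (min_le_right _ _))
    refine le_trans (le_of_eq_of_le (eLpNorm_congr_ae ?_)
      (eLpNorm_mono_measure _ Measure.restrict_le_self)) h3
    filter_upwards [ae_restrict_mem hΩ] with x hx
    rw [Set.indicator_of_mem hx]

theorem gradient_sum_mul {t : Finset (E n)} {η v : E n → E n → ℝ}
    (hη : ∀ p, ContDiff ℝ ∞ (η p)) (hv : ∀ p, ContDiff ℝ ∞ (v p)) (x : E n) :
    gradient (fun z => ∑ p ∈ t, η p z * v p z) x =
      ∑ p ∈ t, (η p x • gradient (v p) x + v p x • gradient (η p) x) := by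
  have hd : ∀ p, HasFDerivAt (fun z => η p z * v p z)
      (η p x • fderiv ℝ (v p) x + v p x • fderiv ℝ (η p) x) x := fun p =>
    ((hη p).differentiable (by simp) x).hasFDerivAt.mul
      ((hv p).differentiable (by simp) x).hasFDerivAt
  rw [gradient, (HasFDerivAt.fun_sum fun p _ => hd p).fderiv, map_sum]
  refine Finset.sum_congr rfl fun p _ => ?_
  rw [map_add, map_smul, map_smul]
  rfl

/-- The sum is constant near each point of the open set `Ω`. This is what lets `u` be subtracted in
the terms carrying derivatives of the cut-offs. -/
theorem sum_gradient_eq_zero (hΩ : IsOpen Ω) {t : Finset (E n)} {η : E n → E n → ℝ}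
    (hη : ∀ p, ContDiff ℝ ∞ (η p)) (hs : ∀ x ∈ Ω, ∑ p ∈ t, η p x = 1) {x : E n} (hx : x ∈ Ω) :
    ∑ p ∈ t, gradient (η p) x = 0 := by
  have h1 : (fun z => ∑ p ∈ t, η p z * 1) =ᶠ[𝓝 x] fun _ => (1 : ℝ) := by
    filter_upwards [hΩ.mem_nhds hx] with z hz
    simp [hs z hz]
  have h2 := gradient_sum_mul (t := t) hη (fun _ => contDiff_const (c := (1 : ℝ))) x
  rw [h1.gradient_eq] at h2
  simpa using h2.symm

/-- On a bounded Lipschitz domain, the restrictions of smooth functions on `ℝⁿ` are dense in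
`H¹(Ω)`, and they belong to `H²(Ω)`. -/
theorem exists_contDiff_norm_sub_le (hΩ : IsBoundedLipschitzDomain Ω) (u : H1 Ω) {ε : ℝ}
    (hε : 0 < ε) : ∃ v : E n → ℝ, ContDiff ℝ ∞ v ∧ ∃ w ∈ H2 Ω,
      (val Ω w : E n → ℝ) =ᵐ[vol Ω] v ∧ (grad Ω w : E n → E n) =ᵐ[vol Ω] gradient v ∧
      ‖w - u‖ ≤ ε := by
  have hm := hΩ.isOpen.measurableSet
  have hK : IsCompact (closure Ω) := hΩ.isBounded.isCompact_closure
  choose! ρ hρ hker using fun p (hp : p ∈ closure Ω) => exists_isKernel hΩ hp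
  obtain ⟨t, η, htK, hη, hηs, hη0, hη1, hηsum⟩ := exists_partition_of_unity hK hρ
  choose! C hC using fun p (hp : p ∈ t) => exists_norm_gradient_le (hη p) (hηs p hp)
  -- Each patch contributes at most `δ` to the function error and `(1 + C p) δ` to the gradient
  -- error, so both totals are at most `M δ ≤ ε / 2`. The extra `1` in the denominator keeps it
  -- positive.
  set M : NNReal := ∑ p ∈ t, (1 + C p) with hM
  set δ : ℝ := ε / 2 / (M + 1) with hδ
  have hδ0 : 0 < δ := by positivity
  have hloc : ∀ p, ∃ (v : E n → ℝ) (H : E n → E n), ContDiff ℝ ∞ v ∧ (p ∈ t →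
      AEStronglyMeasurable H (vol Ω) ∧
      (∀ x ∈ Ω ∩ Metric.ball p (ρ p), HasGradientAt v (H x) x) ∧
      eLpNorm (fun x => v x - val Ω u x) 2 (vol Ω) ≤ ENNReal.ofReal δ ∧
      eLpNorm (fun x => H x - grad Ω u x) 2 (vol Ω) ≤ ENNReal.ofReal δ) := by
    intro p
    by_cases hp : p ∈ t
    · obtain ⟨v, H, hv, h⟩ := exists_local_approx hm u (hker p (htK p hp)) hδ0
      exact ⟨v, H, hv, fun _ => h⟩
    · exact ⟨fun _ => 0, 0, contDiff_const, fun h => absurd h hp⟩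
  choose v H hv hvH using hloc
  have hηm : ∀ p, AEStronglyMeasurable (η p) (vol Ω) := fun p =>
    (hη p).continuous.aestronglyMeasurable
  have hgm : ∀ p, AEStronglyMeasurable (gradient (η p)) (vol Ω) := fun p =>
    (continuous_gradient (hη p)).aestronglyMeasurable
  have hvm : ∀ p, AEStronglyMeasurable (fun x => v p x - val Ω u x) (vol Ω) := fun p =>
    (hv p).continuous.aestronglyMeasurable.sub (Lp.aestronglyMeasurable _)
  have hHm : ∀ p ∈ t, AEStronglyMeasurable (fun x => H p x - grad Ω u x) (vol Ω) := fun p hp =>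
    (hvH p hp).1.sub (Lp.aestronglyMeasurable _)
  have hsmul : ∀ {F : Type} [NormedAddCommGroup F] [NormedSpace ℝ F] (p : E n) (f : E n → F),
      eLpNorm (fun x => η p x • f x) 2 (vol Ω) ≤ eLpNorm f 2 (vol Ω) := fun p f =>
    eLpNorm_mono fun x => by
      rw [norm_smul, Real.norm_of_nonneg (hη0 p x)]
      exact mul_le_of_le_one_left (norm_nonneg _) (hη1 p x)
  have hMsum : ∑ p ∈ t, (ENNReal.ofReal δ + C p * ENNReal.ofReal δ) ≤ ENNReal.ofReal (ε / 2) := by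
    have h1 : ∑ p ∈ t, (ENNReal.ofReal δ + C p * ENNReal.ofReal δ) =
        (M : ℝ≥0∞) * ENNReal.ofReal δ := by
      rw [hM, ENNReal.ofNNReal_finsetSum, Finset.sum_mul]
      exact Finset.sum_congr rfl fun p _ => by push_cast; ring
    rw [h1, ← ENNReal.ofReal_coe_nnreal, ← ENNReal.ofReal_mul (p := (M : ℝ)) M.2]
    refine ENNReal.ofReal_le_ofReal ?_
    rw [hδ, mul_div_assoc', div_le_iff₀ (by positivity)]
    nlinarith [M.2]
  have hV : ContDiff ℝ ∞ fun z => ∑ p ∈ t, η p z * v p z :=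
    ContDiff.sum fun p _ => (hη p).mul (hv p)
  obtain ⟨w, hw, hw1, hw2⟩ := exists_H2_of_contDiff hΩ.isBounded hV
  refine ⟨_, hV, w, hw, hw1, hw2,
    (norm_sub_le_of_eLpNorm hw1 hw2 (half_pos hε).le ?_ ?_).trans_eq (add_halves ε)⟩
  · have h1 : (fun x => ∑ p ∈ t, η p x * v p x - val Ω u x) =ᵐ[vol Ω]
        ∑ p ∈ t, fun x => η p x • (v p x - val Ω u x) := by
      filter_upwards [ae_restrict_mem hm] with x hx
      simp_rw [Finset.sum_apply, smul_eq_mul, mul_sub, Finset.sum_sub_distrib, ← Finset.sum_mul]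
      rw [hηsum x (subset_closure hx), one_mul]
    rw [eLpNorm_congr_ae h1]
    refine (eLpNorm_sum_le (fun p _ => (hηm p).smul (hvm p)) (by norm_num)).trans
      (le_trans (Finset.sum_le_sum fun p hp => ?_) hMsum)
    exact (hsmul p _).trans ((hvH p hp).2.2.1.trans le_self_add)
  -- By the product rule and the two partition identities the gradient error is the sum of `η (H -
  -- ∇u) + (v - u) ∇η`.
  · have h1 : (fun x => gradient (fun z => ∑ p ∈ t, η p z * v p z) x - grad Ω u x) =ᵐ[vol Ω]
        ∑ p ∈ t, ((fun x => η p x • (H p x - grad Ω u x)) +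
          fun x => (v p x - val Ω u x) • gradient (η p) x) := by
      filter_upwards [ae_restrict_mem hm] with x hx
      -- `H p` is the gradient of `v p` only inside the ball, but outside it the cut-off vanishes.
      have h2 : ∀ p ∈ t, η p x • gradient (v p) x = η p x • H p x := by
        intro p hp
        by_cases hxp : x ∈ Metric.ball p (ρ p)
        · rw [((hvH p hp).2.1 x ⟨hx, hxp⟩).gradient]
        · rw [image_eq_zero_of_notMem_tsupport fun h => hxp (hηs p hp h), zero_smul, zero_smul]
      rw [gradient_sum_mul hη hv, Finset.sum_add_distrib, Finset.sum_congr rfl h2]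
      simp_rw [Finset.sum_apply, Pi.add_apply, smul_sub, sub_smul, Finset.sum_add_distrib,
        Finset.sum_sub_distrib, ← Finset.sum_smul, ← Finset.smul_sum]
      rw [hηsum x (subset_closure hx), sum_gradient_eq_zero hΩ.isOpen hη
        (fun z hz => hηsum z (subset_closure hz)) hx, one_smul, smul_zero]
      abel
    rw [eLpNorm_congr_ae h1]
    refine (eLpNorm_sum_le (fun p hp => ((hηm p).smul (hHm p hp)).add ((hvm p).smul (hgm p)))
      (by norm_num)).trans (le_trans (Finset.sum_le_sum fun p hp => ?_) hMsum)
    refine (eLpNorm_add_le ((hηm p).smul (hHm p hp)) ((hvm p).smul (hgm p)) (by norm_num)).trans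
      (add_le_add ((hsmul p _).trans (hvH p hp).2.2.2) ?_)
    refine (eLpNorm_le_nnreal_smul_eLpNorm_of_ae_le_mul (c := C p)
      (g := fun x => v p x - val Ω u x) (Eventually.of_forall fun x => ?_) 2).trans ?_
    · rw [Pi.smul_apply', nnnorm_smul, mul_comm]
      gcongr
      exact hC p hp x
    · rw [ENNReal.smul_def, smul_eq_mul]
      gcongr
      exact (hvH p hp).2.2.1

/-! ### Existence and boundedness of the trace -/

/-- The constant sequence is an admissible approximation. -/
theorem isTrace_of_contDiff {v : E n → ℝ} (hv : ContDiff ℝ ∞ v) {w : H1 Ω}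
    (h1 : (val Ω w : E n → ℝ) =ᵐ[vol Ω] v) (h2 : (grad Ω w : E n → E n) =ᵐ[vol Ω] gradient v)
    {g : Lp ℝ 2 (surf Ω)} (h3 : (g : E n → ℝ) =ᵐ[surf Ω] v) : IsTrace Ω w g := by
  have h0 : ∀ {F : Type} [NormedAddCommGroup F] {μ : Measure (E n)} {f₁ f₂ : E n → F},
      f₂ =ᵐ[μ] f₁ → Tendsto (fun _ : ℕ => eLpNorm (fun x => f₁ x - f₂ x) 2 μ) atTop (𝓝 0) := by
    intro F _ μ f₁ f₂ h
    have h4 : (fun x => f₁ x - f₂ x) =ᵐ[μ] 0 := h.mono fun x hx => by simp [hx]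
    rw [eLpNorm_congr_ae h4, eLpNorm_zero]
    exact tendsto_const_nhds
  exact ⟨fun _ => v, fun _ => hv, h0 h1, h0 h2, h0 h3⟩

theorem tendsto_eLpNorm_sub {F : Type*} [NormedAddCommGroup F] {μ : Measure (E n)}
    {f : ℕ → E n → F} {a : ℕ → Lp F 2 μ} {b : Lp F 2 μ} (hf : ∀ m, a m =ᵐ[μ] f m)
    (hab : Tendsto a atTop (𝓝 b)) :
    Tendsto (fun m => eLpNorm (fun x => f m x - b x) 2 μ) atTop (𝓝 0) := by
  refine (tendsto_iff_edist_tendsto_0.1 hab).congr fun m => ?_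
  rw [Lp.edist_def]
  exact eLpNorm_congr_ae ((hf m).mono fun x hx => by rw [Pi.sub_apply, hx])

/-- On a bounded Lipschitz domain, every element of `H¹(Ω)` has a trace. -/
theorem exists_isTrace (hΩ : IsBoundedLipschitzDomain Ω) (u : H1 Ω) : ∃ g, IsTrace Ω u g := by
  obtain ⟨C, hC⟩ := exists_eLpNorm_surf_le hΩ
  choose v hv w _ hw1 hw2 hwu using fun m : ℕ =>
    exists_contDiff_norm_sub_le hΩ u (Nat.one_div_pos_of_nat (α := ℝ) (n := m))
  have hlim : Tendsto w atTop (𝓝 u) := tendsto_iff_norm_sub_tendsto_zero.2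
    (squeeze_zero (fun _ => norm_nonneg _) hwu tendsto_one_div_add_atTop_nhds_zero_nat)
  have hmem : ∀ m, MemLp (v m) 2 (surf Ω) := fun m =>
    ⟨(hv m).continuous.aestronglyMeasurable, (hC _ (hv m)).trans_lt
      (ENNReal.mul_lt_top ENNReal.coe_lt_top (ENNReal.add_lt_top.2
        ⟨(memLp_of_continuous hΩ.isBounded (hv m).continuous).2,
          (memLp_of_continuous hΩ.isBounded (continuous_gradient (hv m))).2⟩))⟩
  let g : ℕ → Lp ℝ 2 (surf Ω) := fun m => (hmem m).toLp (v m)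
  -- The difference of boundary values is a trace of `w m - w l`, so the a priori bound applies; the
  -- `2` comes from bounding both components by the full norm.
  have hg : ∀ m l, ‖g m - g l‖ ≤ 2 * C * ‖w m - w l‖ := by
    intro m l
    have hd : gradient (fun x => v m x - v l x) = fun x => gradient (v m) x - gradient (v l) x := by
      ext1 x
      rw [gradient, fderiv_fun_sub ((hv m).differentiable (by simp) x)
        ((hv l).differentiable (by simp) x), map_sub]
      rfl
    have ht : IsTrace Ω (w m - w l) (g m - g l) := by
      refine isTrace_of_contDiff ((hv m).sub (hv l)) ?_ ?_ ?_
      · rw [map_sub]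
        filter_upwards [Lp.coeFn_sub (val Ω (w m)) (val Ω (w l)), hw1 m, hw1 l] with x h1 h2 h3
        rw [h1, Pi.sub_apply, h2, h3]
      · rw [map_sub, hd]
        filter_upwards [Lp.coeFn_sub (grad Ω (w m)) (grad Ω (w l)), hw2 m, hw2 l] with x h1 h2 h3
        rw [h1, Pi.sub_apply, h2, h3]
      · filter_upwards [Lp.coeFn_sub (g m) (g l), (hmem m).coeFn_toLp, (hmem l).coeFn_toLp]
          with x h1 h2 h3
        rw [h1, Pi.sub_apply, h2, h3]
    refine (norm_le_of_isTrace hC ht).trans ?_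
    nlinarith [norm_val_le (w m - w l), norm_grad_le (w m - w l), C.2]
  have hcau : CauchySeq g := by
    rw [Metric.cauchySeq_iff']
    intro ε hε
    obtain ⟨N, hN⟩ := Metric.cauchySeq_iff'.1 hlim.cauchySeq (ε / (2 * C + 1)) (by positivity)
    refine ⟨N, fun m hm => ?_⟩
    have h1 := hN m hm
    rw [dist_eq_norm, lt_div_iff₀ (by positivity)] at h1
    rw [dist_eq_norm]
    refine (hg m N).trans_lt (lt_of_le_of_lt ?_ h1)
    nlinarith [norm_nonneg (w m - w N)]
  obtain ⟨b, hb⟩ := cauchySeq_tendsto_of_complete hcau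
  exact ⟨b, v, hv, tendsto_eLpNorm_sub hw1 (((val Ω).continuous.tendsto u).comp hlim),
    tendsto_eLpNorm_sub hw2 (((grad Ω).continuous.tendsto u).comp hlim),
    tendsto_eLpNorm_sub (fun m => (hmem m).coeFn_toLp) hb⟩

theorem isTrace_trace (hΩ : IsBoundedLipschitzDomain Ω) (u : H1 Ω) : IsTrace Ω u (trace Ω u) := by
  have h := exists_isTrace hΩ u
  rw [trace, dif_pos h]
  exact h.choose_spec

/-- The trace inequality. -/
theorem exists_norm_trace_le (hΩ : IsBoundedLipschitzDomain Ω) :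
    ∃ C : ℝ, 0 < C ∧ ∀ u : H1 Ω, ‖trace Ω u‖ ≤ C * ‖u‖ := by
  obtain ⟨C, hC⟩ := exists_eLpNorm_surf_le hΩ
  refine ⟨2 * C + 1, by positivity, fun u => ?_⟩
  refine (norm_le_of_isTrace hC (isTrace_trace hΩ u)).trans ?_
  nlinarith [norm_val_le u, norm_grad_le u, norm_nonneg u, C.2]

/-! ### The approximation error -/

theorem wnorm_le {CT : ℝ} (hT : ∀ u : H1 Ω, ‖trace Ω u‖ ≤ CT * ‖u‖) (c₁ c₂ c₃ : ℝ) (u : H1 Ω) :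
    wnorm c₁ c₂ c₃ u ≤ (|c₁| + |c₂| + |c₃| * CT) * ‖u‖ := by
  have h1 : c₁ * ‖u‖ ≤ |c₁| * ‖u‖ := mul_le_mul_of_nonneg_right (le_abs_self _) (norm_nonneg _)
  have h2 : c₂ * ‖val Ω u‖ ≤ |c₂| * ‖u‖ :=
    mul_le_mul (le_abs_self _) (norm_val_le u) (norm_nonneg _) (abs_nonneg _)
  have h3 : c₃ * ‖trace Ω u‖ ≤ |c₃| * (CT * ‖u‖) :=
    mul_le_mul (le_abs_self _) (hT u) (norm_nonneg _) (abs_nonneg _)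
  rw [wnorm]
  linarith

/-- Chooses the network accuracy; the cap `δ ≤ 1` is what keeps the networks inside the prescribed
balls. -/
theorem exists_pos_mul_le (C : ℝ) {ε : ℝ} (hε : 0 < ε) :
    ∃ δ : ℝ, 0 < δ ∧ δ ≤ 1 ∧ ∀ c ≤ C, ∀ x, 0 ≤ x → x ≤ δ → c * x ≤ ε := by
  refine ⟨min 1 (ε / (|C| + 1)), by positivity, min_le_left _ _, fun c hc x hx hxδ => ?_⟩
  have h1 : x ≤ ε / (|C| + 1) := hxδ.trans (min_le_right _ _)
  rw [le_div_iff₀ (by positivity)] at h1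
  nlinarith [le_abs_self C]

end ObstacleNN

open ObstacleNN in
theorem mainTheorem4 {n : ℕ} (hn : 1 ≤ n) {Ω : Set (E n)} (hΩ : IsBoundedLipschitzDomain Ω)
    (D : Data Ω) (hD : D.IsAdmissible)
    (Ca Cb : ℝ) (hA : D.IsLipschitzCoercive Ca Cb)
    (ustar : H1 Ω) (hu : D.IsSolution ustar)
    (X Y : Set (H1 Ω)) (hXY : D.IsAdmissiblePair ustar X Y)
    (W : Weights) (hγ : 1 / (2 * Ca) < W.γ)
    (hwo1 : 0 ≤ W.wo1) (hwb1 : 0 ≤ W.wb1) (hwo2 : 0 ≤ W.wo2) (hwb2 : 0 ≤ W.wb2)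
    (Fs Ft : Architecture n) (σs σt : ℝ → ℝ)
    (hFs : IsDenseForH2 Ω Fs σs) (hFt : IsUniformlyDenseFor Y Ft σt)
    (R : ℝ) (hR : 0 < R) (hbdd : ∀ v ∈ D.K ∩ Y, ‖v‖ ≤ R)
    (r : ℝ) (hr : ∀ v ∈ D.K ∩ Y, ‖val Ω v‖ ≤ r)
    (P Q : ℝ) (hP : 1 + ‖ustar‖ ≤ P) (hQ : 1 + R ≤ Q) :
    ∃ CT : ℝ, 0 < CT ∧ (∀ u : H1 Ω, ‖trace Ω u‖ ≤ CT * ‖u‖) ∧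
      ∀ B : Bounds, 0 < B.Ms → 0 < B.Bs → 0 < B.Mt → 0 < B.Bt →
        ∀ ε : ℝ, 0 < ε → ∃ ds ws dt wt : ℕ, 0 < ds ∧ 0 < ws ∧ 0 < dt ∧ 0 < wt ∧
          xiApp D Cb r ustar W B Y (Fs.netsBall Ω ds ws σs P) (Ft.netsBall Ω dt wt σt Q)
            ≤ ENNReal.ofReal ε := by
  obtain ⟨CT, hCT, hT⟩ := exists_norm_trace_le hΩ
  refine ⟨CT, hCT, hT, fun B _ _ _ _ ε hε => ?_⟩
  obtain ⟨δt, hδt, hδt1, ht⟩ := exists_pos_mul_le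
    (|K₁ D Cb W B| + |K₂ D r W B| + |K₃ D W B| * CT) (half_pos hε)
  obtain ⟨δs, hδs, hδs1, hs⟩ := exists_pos_mul_le
    (|K₄ D Cb ustar W B| + |K₅ D ustar W B| + |K₆ D W B| * CT) (half_pos hε)
  -- An intermediate target in `H²(Ω)`: half of `δs` is spent on reaching it from `ustar`, the other
  -- half on the network.
  obtain ⟨-, -, z, hz, -, -, hzu⟩ := exists_contDiff_norm_sub_le hΩ ustar (half_pos hδs)
  obtain ⟨ds, ws, hds, hws, u, huN, huz⟩ := hFs z hz (δs / 2) (half_pos hδs)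
  obtain ⟨dt, wt, hdt, hwt, hnet⟩ := hFt δt hδt
  have huu : ‖u - ustar‖ ≤ δs := by
    have h1 := norm_sub_le_norm_sub_add_norm_sub u z ustar
    linarith
  refine ⟨ds, ws, dt, wt, hds, hws, hdt, hwt, ?_⟩
  rw [xiApp, ← add_halves ε, ENNReal.ofReal_add (half_pos hε).le (half_pos hε).le]
  refine add_le_add (iSup₂_le fun v hv => ?_) ?_
  -- The size `dt`, `wt` was fixed before `v`, so only the parameters vary; `‖w‖ ≤ δt + R ≤ 1 + R ≤
  -- Q`.
  · obtain ⟨w, hwN, hwv⟩ := hnet v hv.2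
    have hwQ : ‖w‖ ≤ Q := by
      have h1 := norm_le_norm_sub_add w v
      have h2 := hbdd v hv
      linarith
    exact (iInf₂_le w ⟨hwN, mem_closedBall_zero_iff.2 hwQ⟩).trans (ENNReal.ofReal_le_ofReal
      ((wnorm_le hT _ _ _ _).trans (ht _ le_rfl _ (norm_nonneg _) hwv)))
  · have huP : ‖u‖ ≤ P := by
      have h1 := norm_le_norm_sub_add u ustar
      linarith
    exact (iInf₂_le u ⟨huN, mem_closedBall_zero_iff.2 huP⟩).trans (ENNReal.ofReal_le_ofReal
      ((wnorm_le hT _ _ _ _).trans (hs _ le_rfl _ (norm_nonneg _) huu)))
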